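/- Let $A\in\mathbb R^{n\times n}$, $B\in\mathbb R^{n\times l}$, $E\in\mathbb R^{n\times m}$, $z\in\mathbb R^n$ with $(A,B)$ stabilizable, and put $f(x,u,w)=Ax+Bu+Ew+z$. Let $Q_1,Q_2\in\mathbb R^{n\times n}$ and $R_1,R_2\in\mathbb R^{l\times l}$ be symmetric with $Q_1,Q_2,R_2\ge 0$ and $R_1>0$, and let $s\in\mathbb R^n$, $v\in\mathbb R^l$, $c\in\mathbb R$. Let $(\Omega,\mathcal F,\mathbb P)$ be a probability space carrying an i.i.d. sequence $(W(k))_{k\in\mathbb N_0}$ in $L^2(\Omega;\mathbb R^m)$ with law $\varrho_W$ and mean $\mu_W$. For $X\in L^2(\Omega;\mathbb R^n)$ and $U\in L^2(\Omega;\mathbb R^l)$ define the stage cost $$\ell(X,U)=\mathbb E\big[X^TQ_1X+U^TR_1U+s^TX+v^TU+c\big]+\mathrm{Tr}\big(Q_2\,\mathrm{Cov}(X)\big)+\mathrm{Tr}\big(R_2\,\mathrm{Cov}(U)\big),$$ and for constants $x\in\mathbb R^n$, $u\in\mathbb R^l$ let $\ell(x,u)=x^TQ_1x+u^TR_1u+s^Tx+v^Tu+c$.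 Let $\mathcal P_2(\mathbb R^n)$ be the set of probability measures on $\mathbb R^n$ with finite second moment, and let $\mathbb F(\mathbb R^n,\mathbb R^l)$ be the set of measurable maps $\pi:\mathbb R^n\to\mathbb R^l$ such that $\pi\circ X\in L^2(\Omega;\mathbb R^l)$ for every $X\in L^2(\Omega;\mathbb R^n)$. Assume that the steady-state equation $(I-A)x-Bu=E\mu_W+z$ has a solution $(x,u)$ and that $(A,Q_1^{1/2})$ is detectable. Then the following hold. (a) The algebraic Riccati equation $$P=A^TPA+(Q_1+Q_2)-A^TPB\,[(R_1+R_2)+B^TPB]^{-1}B^TPA$$ has exactly one positive semidefinite solution $P$, and among all solutions $(x,u)$ of the steady-state equation there is exactly one, $(x^\star,u^\star)$, that minimizes $\ell(x,u)$. Set $K=-[(R_1+R_2)+B^TPB]^{-1}B^TPA$ and $\pi^\star(x)=K(x-x^\star)+u^\star$. (b) Call a pair $(\varrho,\pi)$, with $\varrho$ a measure on $\mathbb R^n$ and $\pi\in\mathbb F(\mathbb R^n,\mathbb R^l)$, feasible if there are independent $X\in L^2(\Omega;\mathbb R^n)$ and $W\in L^2(\Omega;\mathbb R^m)$ with $X\sim\varrho$,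 $W\sim\varrho_W$ and $f(X,\pi(X),W)\sim\varrho$. Then there is a distribution $\varrho_X^{s,\star}\in\mathcal P_2(\mathbb R^n)$ such that $(\varrho,\pi^\star)$ is feasible if and only if $\varrho=\varrho_X^{s,\star}$; that is, $\varrho_X^{s,\star}$ is the stationary distribution of the system under the feedback $\pi^\star$. (c) The pair $(\varrho_X^{s,\star},\pi^\star)$ is a solution of the stationary optimization problem of minimizing $\ell(X,\pi\circ X)$, $X\sim\varrho$, over all feasible pairs $(\varrho,\pi)$. (d) Every solution $(\bar\varrho,\bar\pi)$ of this problem satisfies $\bar\varrho=\varrho_X^{s,\star}$. -/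

import Mathlib

open MeasureTheory ProbabilityTheory Matrix
open scoped ENNReal MatrixOrder

noncomputable section

/-! Vectors are elements of `Fin n → ℝ`. Norms enter only through square integrability, which does
not depend on the choice of a norm on a finite-dimensional space. -/

namespace StochLQ

/-- A real square matrix is Schur stable if all its complex eigenvalues lie in the open unit
disc. -/
def SchurStable {n : ℕ} (M : Matrix (Fin n) (Fin n) ℝ) : Prop :=
  ∀ c ∈ spectrum ℂ (M.map (algebraMap ℝ ℂ)), ‖c‖ < 1

/-- `(A, B)` is stabilizable. -/
def Stabilizable {n l : ℕ} (A : Matrix (Fin n) (Fin n) ℝ) (B : Matrix (Fin n) (Fin l) ℝ) : Prop :=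
  ∃ F : Matrix (Fin l) (Fin n) ℝ, SchurStable (A + B * F)

/-- `(A, C)` is detectable. -/
def Detectable {n p : ℕ} (A : Matrix (Fin n) (Fin n) ℝ) (C : Matrix (Fin p) (Fin n) ℝ) : Prop :=
  ∃ L : Matrix (Fin n) (Fin p) ℝ, SchurStable (A + L * C)

/-- The data of the linear system `X⁺ = A X + B U + E W + z` and of the stage cost. -/
structure Data (n l m : ℕ) where
  A : Matrix (Fin n) (Fin n) ℝ
  B : Matrix (Fin n) (Fin l) ℝ
  E : Matrix (Fin n) (Fin m) ℝ
  z : Fin n → ℝ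
  Q₁ : Matrix (Fin n) (Fin n) ℝ
  Q₂ : Matrix (Fin n) (Fin n) ℝ
  R₁ : Matrix (Fin l) (Fin l) ℝ
  R₂ : Matrix (Fin l) (Fin l) ℝ
  s : Fin n → ℝ
  v : Fin l → ℝ
  c : ℝ
  stabilizable : Stabilizable A B
  posSemidef_Q₁ : Q₁.PosSemidef
  posSemidef_Q₂ : Q₂.PosSemidef
  posDef_R₁ : R₁.PosDef
  posSemidef_R₂ : R₂.PosSemidef

/-- The covariance matrix of a random vector. -/
def covMat {Ω : Type*} [MeasurableSpace Ω] (μ : Measure Ω) {d : ℕ} (X : Ω → Fin d → ℝ) :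
    Matrix (Fin d) (Fin d) ℝ :=
  Matrix.of fun i j => cov[fun ω => X ω i, fun ω => X ω j; μ]

/-- `ϱ` is a probability measure with finite second moment. -/
def MemP2 {d : ℕ} (ϱ : Measure (Fin d → ℝ)) : Prop :=
  IsProbabilityMeasure ϱ ∧ ∫⁻ x, ‖x‖ₑ ^ 2 ∂ϱ < ∞

/-- The class of measurable feedbacks `π` with `π ∘ X ∈ L²` for each `X ∈ L²`. -/
def IsFeedback {Ω : Type*} [MeasurableSpace Ω] (μ : Measure Ω) {n l : ℕ}
    (π : (Fin n → ℝ) → (Fin l → ℝ)) : Prop :=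
  Measurable π ∧ ∀ X : Ω → Fin n → ℝ, MemLp X 2 μ → MemLp (π ∘ X) 2 μ

namespace Data

variable {n l m : ℕ} (D : Data n l m)

/-- The dynamics `f(x, u, w) = A x + B u + E w + z`. -/
def f (x : Fin n → ℝ) (u : Fin l → ℝ) (w : Fin m → ℝ) : Fin n → ℝ :=
  D.A *ᵥ x + D.B *ᵥ u + D.E *ᵥ w + D.z

/-- The deterministic stage cost `xᵀ Q₁ x + uᵀ R₁ u + sᵀ x + vᵀ u + c`. -/
def detCost (x : Fin n → ℝ) (u : Fin l → ℝ) : ℝ :=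
  x ⬝ᵥ D.Q₁ *ᵥ x + u ⬝ᵥ D.R₁ *ᵥ u + D.s ⬝ᵥ x + D.v ⬝ᵥ u + D.c

/-- The stochastic stage cost
`𝔼[Xᵀ Q₁ X + Uᵀ R₁ U + sᵀ X + vᵀ U + c] + Tr (Q₂ Cov(X)) + Tr (R₂ Cov(U))`. -/
def stageCost {Ω : Type*} [MeasurableSpace Ω] (μ : Measure Ω)
    (X : Ω → Fin n → ℝ) (U : Ω → Fin l → ℝ) : ℝ :=
  (∫ ω, (X ω ⬝ᵥ D.Q₁ *ᵥ X ω + U ω ⬝ᵥ D.R₁ *ᵥ U ω + D.s ⬝ᵥ X ω + D.v ⬝ᵥ U ω + D.c) ∂μ)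
    + ((D.Q₂ * covMat μ X).trace + (D.R₂ * covMat μ U).trace)

/-- `(x, u)` is a steady state of the deterministic system whose noise is frozen at its mean
`w`. -/
def IsSteadyState (w : Fin m → ℝ) (x : Fin n → ℝ) (u : Fin l → ℝ) : Prop :=
  (1 - D.A) *ᵥ x - D.B *ᵥ u = D.E *ᵥ w + D.z

/-- `(x, u)` minimizes the deterministic stage cost over all steady states. -/
def IsOptimalSteadyState (w : Fin m → ℝ) (x : Fin n → ℝ) (u : Fin l → ℝ) : Prop :=
  D.IsSteadyState w x u ∧ ∀ x' u', D.IsSteadyState w x' u' → D.detCost x u ≤ D.detCost x' u'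

/-- `P` is a positive semidefinite solution of the discrete-time algebraic Riccati equation with
weights `Q₁ + Q₂` and `R₁ + R₂`. -/
def IsRiccatiSolution (P : Matrix (Fin n) (Fin n) ℝ) : Prop :=
  P.PosSemidef ∧
    P = D.Aᵀ * P * D.A + (D.Q₁ + D.Q₂)
      - D.Aᵀ * P * D.B * ((D.R₁ + D.R₂) + D.Bᵀ * P * D.B)⁻¹ * D.Bᵀ * P * D.A

/-- The gain `K = -[(R₁ + R₂) + Bᵀ P B]⁻¹ Bᵀ P A`. -/
def gain (P : Matrix (Fin n) (Fin n) ℝ) : Matrix (Fin l) (Fin n) ℝ :=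
  -(((D.R₁ + D.R₂) + D.Bᵀ * P * D.B)⁻¹ * D.Bᵀ * P * D.A)

/-- The feedback `x ↦ K (x - x⋆) + u⋆`. -/
def optFeedback (P : Matrix (Fin n) (Fin n) ℝ) (xs : Fin n → ℝ) (us : Fin l → ℝ) :
    (Fin n → ℝ) → (Fin l → ℝ) :=
  fun x => D.gain P *ᵥ (x - xs) + us

variable {Ω : Type*} [MeasurableSpace Ω] (μ : Measure Ω) (ϱW : Measure (Fin m → ℝ))

/-- The constraints of the stationary optimization problem for the decision `(ϱ, π)`, with
witnesses `X` and `V` (the noise). -/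
structure IsWitness (ϱ : Measure (Fin n → ℝ)) (π : (Fin n → ℝ) → (Fin l → ℝ))
    (X : Ω → Fin n → ℝ) (V : Ω → Fin m → ℝ) : Prop where
  feedback : IsFeedback μ π
  memLp_state : MemLp X 2 μ
  memLp_noise : MemLp V 2 μ
  law_state : μ.map X = ϱ
  law_noise : μ.map V = ϱW
  indep : IndepFun X V μ
  law_next : μ.map (fun ω => D.f (X ω) (π (X ω)) (V ω)) = ϱ

/-- `(ϱ, π)` is feasible: `ϱ` is invariant under the feedback `π`. -/
def IsFeasible (ϱ : Measure (Fin n → ℝ)) (π : (Fin n → ℝ) → (Fin l → ℝ)) : Prop :=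
  ∃ X V, D.IsWitness μ ϱW ϱ π X V

/-- `(ϱ, π)` solves the stationary optimization problem: it is feasible, and its stage cost
`ℓ(X, π ∘ X)` is minimal among all feasible pairs. -/
def IsSolution (ϱ : Measure (Fin n → ℝ)) (π : (Fin n → ℝ) → (Fin l → ℝ)) : Prop :=
  D.IsFeasible μ ϱW ϱ π ∧
    ∀ X V, D.IsWitness μ ϱW ϱ π X V →
      ∀ ϱ' π' X' V', D.IsWitness μ ϱW ϱ' π' X' V' →
        D.stageCost μ X (π ∘ X) ≤ D.stageCost μ X' (π' ∘ X')

end Data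

end StochLQ

end

/-!
Split the stage cost at a feasible pair into the part depending on means and the part depending on
covariances. The means form a steady state. Stationarity of the covariance turns
`Tr ((Q₁ + Q₂) Cov X) + Tr ((R₁ + R₂) Cov U)` into an expression in which the Riccati solution `P`
completes the square, so that the total cost is the deterministic cost of the means, plus
`Tr (P Cov (E W))`, plus `Tr ((R₁ + R₂ + Bᵀ P B) Cov (U - K X)) ≥ 0`. The first term is minimal
exactly at the optimal steady state, and the last vanishes exactly if `U - K X` is almost surely
constant; both together force the input to be `K (X - x⋆) + u⋆`.

The closed loop `x⁺ = T x + w` with Schur stable `T` has the stationary state `∑ Tᵏ w₋ₖ₋₁`, the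
accumulated past noise. Stationary laws are unique because the characteristic functions of two of
them differ at `ξ` by at most their difference at `(Tᵏ)ᵀ ξ → 0`.
-/

open Filter Topology

namespace StochLQ

section GeometricDecay

theorem summable_norm_pow_of_spectralRadius_lt_one {𝒜 : Type*} [NormedRing 𝒜] [NormedAlgebra ℂ 𝒜]
    [CompleteSpace 𝒜] {a : 𝒜} (ha : spectralRadius ℂ a < 1) : Summable fun k => ‖a ^ k‖ := by
  obtain ⟨r, har, hr⟩ := ENNReal.lt_iff_exists_nnreal_btwn.1 ha
  refine .of_norm_bounded_eventually_nat (summable_geometric_of_lt_one r.2 (mod_cast hr)) ?_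
  filter_upwards [eventually_ne_atTop 0,
    (spectrum.pow_nnnorm_pow_one_div_tendsto_nhds_spectralRadius a).eventually_lt_const har]
    with k hk hlt
  rw [one_div, ENNReal.rpow_inv_lt_iff (by positivity), ENNReal.rpow_natCast] at hlt
  rw [norm_norm]
  exact_mod_cast hlt.le

attribute [local instance] Matrix.linftyOpNormedRing Matrix.linftyOpNormedAlgebra

variable {n : ℕ} {M : Matrix (Fin n) (Fin n) ℝ}

theorem SchurStable.summable_norm_pow (hM : SchurStable M) : Summable fun k => ‖M ^ k‖ := by
  have hradius : spectralRadius ℂ (M.map (algebraMap ℝ ℂ)) < (1 : NNReal) := by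
    rcases (spectrum ℂ (M.map (algebraMap ℝ ℂ))).eq_empty_or_nonempty with hempty | hne
    · simp only [spectralRadius, hempty, Set.mem_empty_iff_false, iSup_false, iSup_bot]
      exact zero_lt_one
    · exact spectrum.spectralRadius_lt_of_forall_lt_of_nonempty hne hM
  have hmap (k : ℕ) : M.map (algebraMap ℝ ℂ) ^ k = (M ^ k).map (algebraMap ℝ ℂ) :=
    (map_pow (algebraMap ℝ ℂ).mapMatrix M k).symm
  simpa only [hmap, linfty_opNorm_def, map_apply, nnnorm_algebraMap', NNReal.coe_one] using
    summable_norm_pow_of_spectralRadius_lt_one hradius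

theorem SchurStable.summable_norm_mulVecLin_pow (hM : SchurStable M) :
    Summable fun k => ‖M.mulVecLin.toContinuousLinearMap ^ k‖ := by
  have hpow (k : ℕ) :
      M.mulVecLin.toContinuousLinearMap ^ k = (M ^ k).mulVecLin.toContinuousLinearMap :=
    ContinuousLinearMap.coe_injective <| by
      simpa [ContinuousLinearMap.toLinearMap_pow, toLin'_apply'] using (toLin'_pow M k).symm
  simp only [hpow]
  exact hM.summable_norm_pow.congr fun k => linfty_opNorm_eq_opNorm (M ^ k)

theorem SchurStable.tendsto_pow (hM : SchurStable M) : Tendsto (fun k => M ^ k) atTop (𝓝 0) :=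
  tendsto_zero_iff_norm_tendsto_zero.2 hM.summable_norm_pow.tendsto_atTop_zero

theorem SchurStable.tendsto_pow_mulVec (hM : SchurStable M) (x : Fin n → ℝ) :
    Tendsto (fun k => M ^ k *ᵥ x) atTop (𝓝 0) := by
  have hcont : Continuous fun N : Matrix (Fin n) (Fin n) ℝ => N *ᵥ x := by fun_prop
  simpa only [zero_mulVec, Function.comp_def] using (hcont.tendsto 0).comp hM.tendsto_pow

theorem SchurStable.eq_zero_of_mulVec_eq (hM : SchurStable M) {x : Fin n → ℝ}
    (hx : M *ᵥ x = x) : x = 0 := by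
  have hpow (k : ℕ) : M ^ k *ᵥ x = x := by
    induction k with
    | zero => simp
    | succ k ih => rw [pow_succ, ← mulVec_mulVec, hx, ih]
  simpa [hpow] using hM.tendsto_pow_mulVec x

theorem schurStable_iff_forall_eigenvector :
    SchurStable M ↔ ∀ (c : ℂ) (v : Fin n → ℂ), v ≠ 0 →
      M.map (algebraMap ℝ ℂ) *ᵥ v = c • v → ‖c‖ < 1 := by
  simp only [SchurStable, ← Matrix.spectrum_toLin', ← Module.End.hasEigenvalue_iff_mem_spectrum]
  refine ⟨fun h c v hv hMv => h c (Module.End.hasEigenvalue_of_hasEigenvector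
    ⟨Module.End.mem_eigenspace_iff.2 hMv, hv⟩), fun h c hc => ?_⟩
  obtain ⟨v, hv⟩ := hc.exists_hasEigenvector
  exact h c v hv.2 hv.apply_eq_smul

end GeometricDecay

section QuadraticForm

theorem isSymm_of_posSemidef {ι : Type*} {M : Matrix ι ι ℝ} (hM : M.PosSemidef) : M.IsSymm :=
  isHermitian_iff_isSymm.1 hM.isHermitian

variable {𝕜 ι κ : Type*} [CommRing 𝕜] [Fintype ι]

theorem dotProduct_mulVec_comm_of_isSymm {M : Matrix ι ι 𝕜} (hM : M.IsSymm) (x y : ι → 𝕜) :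
    x ⬝ᵥ M *ᵥ y = y ⬝ᵥ M *ᵥ x := by
  rw [dotProduct_mulVec, ← mulVec_transpose, hM.eq, dotProduct_comm]

theorem dotProduct_add_mulVec_add {M : Matrix ι ι 𝕜} (hM : M.IsSymm) (x y : ι → 𝕜) :
    (x + y) ⬝ᵥ M *ᵥ (x + y) = x ⬝ᵥ M *ᵥ x + 2 * (x ⬝ᵥ M *ᵥ y) + y ⬝ᵥ M *ᵥ y := by
  rw [mulVec_add, dotProduct_add, add_dotProduct, add_dotProduct,
    dotProduct_mulVec_comm_of_isSymm hM y x]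
  ring

theorem dotProduct_transpose_mul_mul_mulVec [Fintype κ] (P : Matrix ι ι 𝕜) (M : Matrix ι κ 𝕜)
    (x : κ → 𝕜) :
    x ⬝ᵥ (Mᵀ * P * M) *ᵥ x = (M *ᵥ x) ⬝ᵥ P *ᵥ (M *ᵥ x) := by
  rw [← mulVec_mulVec, ← mulVec_mulVec, dotProduct_mulVec, vecMul_transpose]

theorem posSemidef_transpose_mul_mul [Finite κ] {P : Matrix ι ι ℝ} (hP : P.PosSemidef)
    (M : Matrix ι κ ℝ) :
    (Mᵀ * P * M).PosSemidef := by
  simpa using hP.conjTranspose_mul_mul_same M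

theorem transpose_mul_mul_le [Finite κ] {P P' : Matrix ι ι ℝ} (h : P ≤ P') (M : Matrix ι κ ℝ) :
    Mᵀ * P * M ≤ Mᵀ * P' * M := by
  rw [Matrix.le_iff, ← Matrix.sub_mul, ← Matrix.mul_sub]
  exact posSemidef_transpose_mul_mul (Matrix.le_iff.1 h) M

theorem dotProduct_mulVec_mono {M N : Matrix ι ι ℝ} (h : M ≤ N) (x : ι → ℝ) :
    x ⬝ᵥ M *ᵥ x ≤ x ⬝ᵥ N *ᵥ x := by
  have := (Matrix.le_iff.1 h).dotProduct_mulVec_nonneg x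
  rwa [star_trivial, sub_mulVec, dotProduct_sub, sub_nonneg] at this

theorem apply_eq_half_polarization [DecidableEq ι] {M : Matrix ι ι ℝ} (hM : M.IsSymm) (i j : ι) :
    M i j = ((Pi.single i 1 + Pi.single j 1) ⬝ᵥ M *ᵥ (Pi.single i 1 + Pi.single j 1)
      - Pi.single i 1 ⬝ᵥ M *ᵥ Pi.single i 1 - Pi.single j 1 ⬝ᵥ M *ᵥ Pi.single j 1) / 2 := by
  rw [dotProduct_add_mulVec_add hM]
  simp only [mulVec_single_one, single_one_dotProduct, col_apply]
  ring

theorem isClosed_setOf_posSemidef {ι : Type*} [Finite ι] :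
    IsClosed {M : Matrix ι ι ℝ | M.PosSemidef} := by
  have := Fintype.ofFinite ι
  simp only [posSemidef_iff_dotProduct_mulVec, Set.ofPred_and, Set.ofPred_forall]
  exact (isClosed_eq (by fun_prop) continuous_id).inter
    (isClosed_iInter fun x => isClosed_le continuous_const (by fun_prop))

theorem exists_tendsto_of_monotone_of_le {ι : Type*} [Finite ι] {P : ℕ → Matrix ι ι ℝ}
    {U : Matrix ι ι ℝ} (hsymm : ∀ k, (P k).IsSymm) (hmono : Monotone P) (hU : ∀ k, P k ≤ U) :
    ∃ P', Tendsto P atTop (𝓝 P') := by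
  classical
  have := Fintype.ofFinite ι
  have hquad (x : ι → ℝ) : ∃ y, Tendsto (fun k => x ⬝ᵥ P k *ᵥ x) atTop (𝓝 y) :=
    ⟨_, tendsto_atTop_ciSup (fun _ _ hij => dotProduct_mulVec_mono (hmono hij) x)
      ⟨x ⬝ᵥ U *ᵥ x, Set.forall_mem_range.2 fun k => dotProduct_mulVec_mono (hU k) x⟩⟩
  choose q hq using hquad
  refine ⟨Matrix.of fun i j => (q (Pi.single i 1 + Pi.single j 1) - q (Pi.single i 1)
    - q (Pi.single j 1)) / 2, tendsto_pi_nhds.2 fun i => tendsto_pi_nhds.2 fun j => ?_⟩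
  exact ((((hq _).sub (hq _)).sub (hq _)).div_const 2).congr fun k =>
    (apply_eq_half_polarization (hsymm k) i j).symm

open scoped Classical in
theorem conjTranspose_sqrt_mul_sqrt {M : Matrix ι ι ℝ} (hM : M.PosSemidef) :
    (CFC.sqrt M)ᴴ * CFC.sqrt M = M := by
  rw [(Matrix.nonneg_iff_posSemidef.1 (CFC.sqrt_nonneg M)).isHermitian.eq,
    CFC.sqrt_mul_sqrt_self M hM.nonneg]

open scoped Classical in
theorem sqrt_mulVec_eq_zero_iff {M : Matrix ι ι ℝ} (hM : M.PosSemidef)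
    {x : ι → ℝ} : CFC.sqrt M *ᵥ x = 0 ↔ M *ᵥ x = 0 := by
  rw [← conjTranspose_mul_self_mulVec_eq_zero, conjTranspose_sqrt_mul_sqrt hM]

end QuadraticForm

section RiccatiOperator

variable {𝕜 ι κ : Type*} [CommRing 𝕜] [Fintype ι] [Fintype κ]

/-- The cost-to-go after one step from the cost-to-go `P`, when the input of the system
`x⁺ = A x + B u` with stage weights `Q` and `R` is generated by the gain `K`. -/
def closedLoopCost (A : Matrix ι ι 𝕜) (B : Matrix ι κ 𝕜) (Q : Matrix ι ι 𝕜) (R : Matrix κ κ 𝕜)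
    (K : Matrix κ ι 𝕜) (P : Matrix ι ι 𝕜) : Matrix ι ι 𝕜 :=
  Q + Kᵀ * R * K + (A + B * K)ᵀ * P * (A + B * K)

theorem dotProduct_closedLoopCost_mulVec (A : Matrix ι ι 𝕜) (B : Matrix ι κ 𝕜) (Q : Matrix ι ι 𝕜)
    (R : Matrix κ κ 𝕜) (K : Matrix κ ι 𝕜) (P : Matrix ι ι 𝕜) (x : ι → 𝕜) :
    x ⬝ᵥ closedLoopCost A B Q R K P *ᵥ x = x ⬝ᵥ Q *ᵥ x + (K *ᵥ x) ⬝ᵥ R *ᵥ (K *ᵥ x)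
      + (A *ᵥ x + B *ᵥ K *ᵥ x) ⬝ᵥ P *ᵥ (A *ᵥ x + B *ᵥ K *ᵥ x) := by
  rw [closedLoopCost, add_mulVec, add_mulVec, dotProduct_add, dotProduct_add,
    dotProduct_transpose_mul_mul_mulVec, dotProduct_transpose_mul_mul_mulVec, add_mulVec,
    ← mulVec_mulVec x B]

variable [DecidableEq κ]

/-- The Riccati operator, which maps the cost-to-go `P` to the optimal cost-to-go one step
earlier. -/
noncomputable def riccati (A : Matrix ι ι 𝕜) (B : Matrix ι κ 𝕜) (Q : Matrix ι ι 𝕜)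
    (R : Matrix κ κ 𝕜) (P : Matrix ι ι 𝕜) : Matrix ι ι 𝕜 :=
  Aᵀ * P * A + Q - Aᵀ * P * B * (R + Bᵀ * P * B)⁻¹ * Bᵀ * P * A

/-- The optimal gain for the cost-to-go `P`. -/
noncomputable def riccatiGain (A : Matrix ι ι 𝕜) (B : Matrix ι κ 𝕜) (R : Matrix κ κ 𝕜)
    (P : Matrix ι ι 𝕜) : Matrix κ ι 𝕜 :=
  -((R + Bᵀ * P * B)⁻¹ * Bᵀ * P * A)

theorem mul_riccatiGain (A : Matrix ι ι 𝕜) {B : Matrix ι κ 𝕜} {R : Matrix κ κ 𝕜}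
    {P : Matrix ι ι 𝕜} (hS : IsUnit (R + Bᵀ * P * B).det) :
    (R + Bᵀ * P * B) * riccatiGain A B R P = -(Bᵀ * P * A) := by
  rw [riccatiGain, Matrix.mul_neg, Matrix.mul_assoc _ Bᵀ, Matrix.mul_assoc _ (Bᵀ * P),
    mul_nonsing_inv_cancel_left _ _ hS]

theorem transpose_mul_mul_sub_riccatiGain (A : Matrix ι ι 𝕜) (B : Matrix ι κ 𝕜)
    {R : Matrix κ κ 𝕜} {P : Matrix ι ι 𝕜} (hR : R.IsSymm) (hP : P.IsSymm)
    (hS : IsUnit (R + Bᵀ * P * B).det) (K : Matrix κ ι 𝕜) :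
    (K - riccatiGain A B R P)ᵀ * (R + Bᵀ * P * B) * (K - riccatiGain A B R P) =
      Kᵀ * (R + Bᵀ * P * B) * K + Kᵀ * (Bᵀ * P * A) + Aᵀ * P * B * K
        - Aᵀ * P * B * riccatiGain A B R P := by
  have hSG := mul_riccatiGain A hS
  set S := R + Bᵀ * P * B with hSdef
  set G := riccatiGain A B R P
  have hSymm : Sᵀ = S := by
    simp [hSdef, transpose_mul, hR.eq, hP.eq, Matrix.mul_assoc]
  have hGS : Gᵀ * S = -(Aᵀ * P * B) := by
    simpa [transpose_mul, hSymm, hP.eq, Matrix.mul_assoc] using congrArg transpose hSG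
  calc (K - G)ᵀ * S * (K - G) = Kᵀ * S * K - Kᵀ * (S * G) - Gᵀ * S * K + Gᵀ * S * G := by
        simp only [transpose_sub, Matrix.sub_mul, Matrix.mul_sub, Matrix.mul_assoc]; abel
    _ = _ := by rw [hSG, hGS]; simp only [Matrix.mul_neg, Matrix.neg_mul]; abel

theorem closedLoopCost_eq_riccati_add (A : Matrix ι ι 𝕜) (B : Matrix ι κ 𝕜) (Q : Matrix ι ι 𝕜)
    {R : Matrix κ κ 𝕜} {P : Matrix ι ι 𝕜} (hR : R.IsSymm) (hP : P.IsSymm)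
    (hS : IsUnit (R + Bᵀ * P * B).det) (K : Matrix κ ι 𝕜) :
    closedLoopCost A B Q R K P = riccati A B Q R P +
      (K - riccatiGain A B R P)ᵀ * (R + Bᵀ * P * B) * (K - riccatiGain A B R P) := by
  rw [transpose_mul_mul_sub_riccatiGain A B hR hP hS]
  simp only [closedLoopCost, riccati, riccatiGain, transpose_add, transpose_mul, Matrix.mul_add,
    Matrix.add_mul, Matrix.mul_neg, Matrix.mul_assoc]
  abel

end RiccatiOperator

section RiccatiOrder

variable {ι κ : Type*} [Fintype ι] {A : Matrix ι ι ℝ} {B : Matrix ι κ ℝ}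
  {Q : Matrix ι ι ℝ} {R : Matrix κ κ ℝ} {P P' : Matrix ι ι ℝ}

theorem posDef_add_transpose_mul_mul [Finite κ] (B : Matrix ι κ ℝ) (hR : R.PosDef)
    (hP : P.PosSemidef) : (R + Bᵀ * P * B).PosDef :=
  hR.add_posSemidef (posSemidef_transpose_mul_mul hP B)

variable [Fintype κ]

theorem closedLoopCost_mono (A : Matrix ι ι ℝ) (B : Matrix ι κ ℝ) (Q : Matrix ι ι ℝ)
    (R : Matrix κ κ ℝ) (K : Matrix κ ι ℝ) (h : P ≤ P') :
    closedLoopCost A B Q R K P ≤ closedLoopCost A B Q R K P' :=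
  add_le_add_right (transpose_mul_mul_le h _) _

theorem posSemidef_closedLoopCost (hQ : Q.PosSemidef) (hR : R.PosSemidef) (K : Matrix κ ι ℝ)
    (hP : P.PosSemidef) : (closedLoopCost A B Q R K P).PosSemidef :=
  (hQ.add (posSemidef_transpose_mul_mul hR K)).add (posSemidef_transpose_mul_mul hP _)

variable [DecidableEq κ]

theorem isUnit_det_add_transpose_mul_mul (B : Matrix ι κ ℝ) (hR : R.PosDef)
    (hP : P.PosSemidef) : IsUnit (R + Bᵀ * P * B).det :=
  (posDef_add_transpose_mul_mul B hR hP).det_pos.ne'.isUnit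

theorem closedLoopCost_eq_riccati_add_of_posDef (A : Matrix ι ι ℝ) (B : Matrix ι κ ℝ)
    (Q : Matrix ι ι ℝ) (hR : R.PosDef) (hP : P.PosSemidef) (K : Matrix κ ι ℝ) :
    closedLoopCost A B Q R K P = riccati A B Q R P +
      (K - riccatiGain A B R P)ᵀ * (R + Bᵀ * P * B) * (K - riccatiGain A B R P) :=
  closedLoopCost_eq_riccati_add A B Q (isSymm_of_posSemidef hR.posSemidef) (isSymm_of_posSemidef hP)
    (isUnit_det_add_transpose_mul_mul B hR hP) K

theorem riccati_eq_closedLoopCost (A : Matrix ι ι ℝ) (B : Matrix ι κ ℝ) (Q : Matrix ι ι ℝ)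
    (hR : R.PosDef) (hP : P.PosSemidef) :
    riccati A B Q R P = closedLoopCost A B Q R (riccatiGain A B R P) P := by
  simp [closedLoopCost_eq_riccati_add_of_posDef A B Q hR hP]

theorem quadraticForm_add_eq_riccati_add (A : Matrix ι ι ℝ) (B : Matrix ι κ ℝ)
    (Q : Matrix ι ι ℝ) (hR : R.PosDef) (hP : P.PosSemidef) (x : ι → ℝ) (u : κ → ℝ) :
    x ⬝ᵥ Q *ᵥ x + u ⬝ᵥ R *ᵥ u + (A *ᵥ x + B *ᵥ u) ⬝ᵥ P *ᵥ (A *ᵥ x + B *ᵥ u) =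
      x ⬝ᵥ riccati A B Q R P *ᵥ x + (u - riccatiGain A B R P *ᵥ x) ⬝ᵥ (R + Bᵀ * P * B) *ᵥ
        (u - riccatiGain A B R P *ᵥ x) := by
  have hSG := congrArg (· *ᵥ x) (mul_riccatiGain A (isUnit_det_add_transpose_mul_mul B hR hP))
  set G := riccatiGain A B R P with hG
  obtain ⟨d, rfl⟩ : ∃ d, u = G *ᵥ x + d := ⟨u - G *ᵥ x, by abel⟩
  have hstationary : d ⬝ᵥ R *ᵥ G *ᵥ x + (B *ᵥ d) ⬝ᵥ P *ᵥ (A *ᵥ x + B *ᵥ G *ᵥ x) = 0 := by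
    have hadj (y : ι → ℝ) : (B *ᵥ d) ⬝ᵥ y = d ⬝ᵥ Bᵀ *ᵥ y := by
      rw [dotProduct_mulVec, vecMul_transpose]
    rw [hadj, ← dotProduct_add]
    convert dotProduct_zero d using 2
    rw [← add_neg_cancel ((Bᵀ * P * A) *ᵥ x), ← neg_mulVec, ← hSG]
    simp only [mulVec_add, Matrix.add_mul, add_mulVec, mulVec_mulVec, Matrix.mul_assoc]
    abel
  rw [riccati_eq_closedLoopCost A B Q hR hP, dotProduct_closedLoopCost_mulVec, ← hG,
    add_sub_cancel_left, mulVec_add B, ← add_assoc,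
    dotProduct_add_mulVec_add (isSymm_of_posSemidef hR.posSemidef),
    dotProduct_add_mulVec_add (isSymm_of_posSemidef hP), add_mulVec, dotProduct_add,
    dotProduct_transpose_mul_mul_mulVec,
    dotProduct_mulVec_comm_of_isSymm (isSymm_of_posSemidef hR.posSemidef) _ d,
    dotProduct_mulVec_comm_of_isSymm (isSymm_of_posSemidef hP) _ (B *ᵥ d)]
  linear_combination 2 * hstationary

theorem riccati_le_closedLoopCost (A : Matrix ι ι ℝ) (B : Matrix ι κ ℝ) (Q : Matrix ι ι ℝ)
    (hR : R.PosDef) (hP : P.PosSemidef) (K : Matrix κ ι ℝ) :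
    riccati A B Q R P ≤ closedLoopCost A B Q R K P := by
  rw [closedLoopCost_eq_riccati_add_of_posDef A B Q hR hP, Matrix.le_iff, add_sub_cancel_left]
  exact posSemidef_transpose_mul_mul (posDef_add_transpose_mul_mul B hR hP).posSemidef _

theorem riccati_mono (hR : R.PosDef) (hP : P.PosSemidef) (hP' : P'.PosSemidef) (h : P ≤ P') :
    riccati A B Q R P ≤ riccati A B Q R P' :=
  calc riccati A B Q R P ≤ closedLoopCost A B Q R (riccatiGain A B R P') P :=
        riccati_le_closedLoopCost A B Q hR hP _
    _ ≤ closedLoopCost A B Q R (riccatiGain A B R P') P' := closedLoopCost_mono A B Q R _ h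
    _ = riccati A B Q R P' := (riccati_eq_closedLoopCost A B Q hR hP').symm

theorem posSemidef_riccati (hQ : Q.PosSemidef) (hR : R.PosDef) (hP : P.PosSemidef) :
    (riccati A B Q R P).PosSemidef := by
  rw [riccati_eq_closedLoopCost A B Q hR hP]
  exact posSemidef_closedLoopCost hQ hR.posSemidef _ hP

theorem posSemidef_iterate_riccati (A : Matrix ι ι ℝ) (B : Matrix ι κ ℝ) (hQ : Q.PosSemidef)
    (hR : R.PosDef) (k : ℕ) : ((riccati A B Q R)^[k] 0).PosSemidef :=
  Function.Iterate.rec PosSemidef .zero (fun _ => posSemidef_riccati hQ hR) k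

theorem monotone_iterate_riccati (A : Matrix ι ι ℝ) (B : Matrix ι κ ℝ) (hQ : Q.PosSemidef)
    (hR : R.PosDef) : Monotone fun k => (riccati A B Q R)^[k] 0 := by
  have hpos := posSemidef_iterate_riccati A B hQ hR
  refine monotone_nat_of_le_succ fun k => ?_
  induction k with
  | zero => exact Matrix.nonneg_iff_posSemidef.2 (hpos 1)
  | succ k ih =>
    rw [Function.iterate_succ_apply', Function.iterate_succ_apply' _ (k + 1)]
    exact riccati_mono hR (hpos k) (hpos (k + 1)) ih

theorem iterate_riccati_le (hQ : Q.PosSemidef) (hR : R.PosDef) {K : Matrix κ ι ℝ}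
    (hP : P.PosSemidef) (hK : closedLoopCost A B Q R K P ≤ P) (k : ℕ) :
    (riccati A B Q R)^[k] 0 ≤ P := by
  induction k with
  | zero => exact Matrix.nonneg_iff_posSemidef.2 hP
  | succ k ih =>
    rw [Function.iterate_succ_apply']
    exact (riccati_le_closedLoopCost A B Q hR (posSemidef_iterate_riccati A B hQ hR k) K).trans
      ((closedLoopCost_mono A B Q R K ih).trans hK)

theorem continuousAt_riccati (A : Matrix ι ι ℝ) (B : Matrix ι κ ℝ) (Q : Matrix ι ι ℝ)
    (hR : R.PosDef) (hP : P.PosSemidef) : ContinuousAt (riccati A B Q R) P := by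
  have hinv : ContinuousAt (fun P : Matrix ι ι ℝ => (R + Bᵀ * P * B)⁻¹) P := by
    refine ContinuousAt.comp (g := Inv.inv) (continuousAt_matrix_inv _ ?_)
      (Continuous.continuousAt (by fun_prop))
    rw [Ring.inverse_eq_inv']
    exact continuousAt_inv₀ (posDef_add_transpose_mul_mul B hR hP).det_pos.ne'
  have hpoly : Continuous fun p : Matrix ι ι ℝ × Matrix κ κ ℝ =>
      Aᵀ * p.1 * A + Q - Aᵀ * p.1 * B * p.2 * Bᵀ * p.1 * A :=
    ((continuous_const.matrix_mul continuous_fst).matrix_mul continuous_const).add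
      continuous_const |>.sub <| ((((continuous_const.matrix_mul continuous_fst).matrix_mul
        continuous_const).matrix_mul continuous_snd).matrix_mul continuous_const).matrix_mul
          continuous_fst |>.matrix_mul continuous_const
  exact hpoly.continuousAt.comp (f := fun P : Matrix ι ι ℝ => (P, (R + Bᵀ * P * B)⁻¹))
    (continuousAt_id.prodMk hinv)

/-- Value iteration from zero converges: its iterates increase and are bounded by the cost-to-go of
any gain that dominates its own closed-loop update. -/
theorem exists_isFixedPt_riccati (hQ : Q.PosSemidef) (hR : R.PosDef) {K : Matrix κ ι ℝ}
    (hP : P.PosSemidef) (hK : closedLoopCost A B Q R K P ≤ P) :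
    ∃ P' : Matrix ι ι ℝ, P'.PosSemidef ∧ Function.IsFixedPt (riccati A B Q R) P' := by
  have hpos := posSemidef_iterate_riccati A B hQ hR
  obtain ⟨P', hlim⟩ := exists_tendsto_of_monotone_of_le (fun k => isSymm_of_posSemidef (hpos k))
    (monotone_iterate_riccati A B hQ hR) (iterate_riccati_le hQ hR hP hK)
  have hP' : P'.PosSemidef := isClosed_setOf_posSemidef.mem_of_tendsto hlim (.of_forall hpos)
  exact ⟨P', hP', isFixedPt_of_tendsto_iterate hlim (continuousAt_riccati A B Q hR hP')⟩

end RiccatiOrder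

section Lyapunov

theorem conjTranspose_map_algebraMap_complex {ι κ : Type*} (N : Matrix ι κ ℝ) :
    (N.map (algebraMap ℝ ℂ))ᴴ = Nᵀ.map (algebraMap ℝ ℂ) := by
  ext i j
  exact Complex.conj_ofReal (N j i)

open scoped ComplexOrder in
theorem posSemidef_map_algebraMap_complex {ι : Type*} [Finite ι] {P : Matrix ι ι ℝ}
    (hP : P.PosSemidef) : (P.map (algebraMap ℝ ℂ)).PosSemidef := by
  classical
  have := Fintype.ofFinite ι
  rw [← conjTranspose_sqrt_mul_sqrt hP, Matrix.map_mul, conjTranspose_eq_transpose_of_trivial,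
    ← conjTranspose_map_algebraMap_complex]
  exact posSemidef_conjTranspose_mul_self _

theorem map_algebraMap_complex_mulVec_eq_zero_iff {ι κ : Type*} [Fintype κ] (N : Matrix ι κ ℝ)
    (v : κ → ℂ) : N.map (algebraMap ℝ ℂ) *ᵥ v = 0 ↔
      N *ᵥ (fun j => (v j).re) = 0 ∧ N *ᵥ (fun j => (v j).im) = 0 := by
  simp [funext_iff, Complex.ext_iff, mulVec, dotProduct, forall_and]

open scoped ComplexOrder in
theorem mulVec_eq_zero_of_lyapunov_eq {𝕜 ι : Type*} [RCLike 𝕜] [Fintype ι] {M P W : Matrix ι ι 𝕜}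
    (hP : P.PosSemidef) (hW : W.PosSemidef) (hPW : W + Mᴴ * P * M = P) {c : 𝕜} {v : ι → 𝕜}
    (hv : M *ᵥ v = c • v) (hc : 1 ≤ ‖c‖) : W *ᵥ v = 0 := by
  have hexpand : star v ⬝ᵥ W *ᵥ v = ((1 - ‖c‖ ^ 2 : ℝ) : 𝕜) * (star v ⬝ᵥ P *ᵥ v) := by
    have hPv : star v ⬝ᵥ P *ᵥ v = star v ⬝ᵥ W *ᵥ v + (‖c‖ ^ 2 : 𝕜) * (star v ⬝ᵥ P *ᵥ v) := by
      nth_rw 1 [← hPW]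
      rw [add_mulVec, dotProduct_add, ← mulVec_mulVec, ← mulVec_mulVec, dotProduct_mulVec _ Mᴴ,
        ← star_mulVec, hv, mulVec_smul, star_smul, smul_dotProduct, dotProduct_smul, smul_smul,
        RCLike.star_def, RCLike.conj_mul, smul_eq_mul]
    push_cast
    linear_combination -hPv
  have hnonpos : star v ⬝ᵥ W *ᵥ v ≤ 0 := by
    rw [hexpand]
    exact mul_nonpos_of_nonpos_of_nonneg (mod_cast by nlinarith) (hP.dotProduct_mulVec_nonneg v)
  exact (hW.dotProduct_mulVec_zero_iff v).1 (hnonpos.antisymm (hW.dotProduct_mulVec_nonneg v))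

variable {n : ℕ} {M M' P W : Matrix (Fin n) (Fin n) ℝ}

/-- An unstable eigenvector of `M` is annihilated by `W`, hence is an unstable eigenvector of
`M'`. -/
theorem schurStable_of_lyapunov_eq (hM' : SchurStable M') (hP : P.PosSemidef) (hW : W.PosSemidef)
    (hPW : W + Mᵀ * P * M = P) (hMM' : ∀ x, W *ᵥ x = 0 → M *ᵥ x = M' *ᵥ x) : SchurStable M := by
  refine schurStable_iff_forall_eigenvector.2 fun c v hv hMv => not_le.1 fun hc => ?_
  have hPWc : W.map (algebraMap ℝ ℂ) + (M.map (algebraMap ℝ ℂ))ᴴ * P.map (algebraMap ℝ ℂ)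
      * M.map (algebraMap ℝ ℂ) = P.map (algebraMap ℝ ℂ) := by
    have := congrArg (fun N => N.map (algebraMap ℝ ℂ)) hPW
    rwa [Matrix.map_add _ (map_add _), Matrix.map_mul, Matrix.map_mul,
      ← conjTranspose_map_algebraMap_complex] at this
  have hWv := (map_algebraMap_complex_mulVec_eq_zero_iff W v).1 <|
    mulVec_eq_zero_of_lyapunov_eq (posSemidef_map_algebraMap_complex hP)
      (posSemidef_map_algebraMap_complex hW) hPWc hMv hc
  have hsub : (M - M').map (algebraMap ℝ ℂ) *ᵥ v = 0 :=
    (map_algebraMap_complex_mulVec_eq_zero_iff _ _).2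
      ⟨by rw [sub_mulVec, hMM' _ hWv.1, sub_self], by rw [sub_mulVec, hMM' _ hWv.2, sub_self]⟩
  rw [Matrix.map_sub _ (map_sub _), sub_mulVec, sub_eq_zero, hMv] at hsub
  exact hc.not_gt (schurStable_iff_forall_eigenvector.1 hM' c v hv hsub.symm)

theorem SchurStable.posSemidef_of_transpose_mul_mul_le (hM : SchurStable M)
    (hP : Mᵀ * P * M ≤ P) : P.PosSemidef := by
  have hpow (k : ℕ) : (M ^ k)ᵀ * P * M ^ k ≤ P := by
    induction k with
    | zero => simp
    | succ k ih =>
      calc (M ^ (k + 1))ᵀ * P * M ^ (k + 1) = Mᵀ * ((M ^ k)ᵀ * P * M ^ k) * M := by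
            simp only [pow_succ, transpose_mul, Matrix.mul_assoc]
        _ ≤ Mᵀ * P * M := transpose_mul_mul_le ih M
        _ ≤ P := hP
  have hcont : Continuous fun N : Matrix (Fin n) (Fin n) ℝ => P - Nᵀ * P * N := by fun_prop
  have hlim := (hcont.tendsto 0).comp hM.tendsto_pow
  rw [Matrix.mul_zero, sub_zero] at hlim
  exact isClosed_setOf_posSemidef.mem_of_tendsto hlim (.of_forall hpow)

attribute [local instance] Matrix.linftyOpNormedRing Matrix.linftyOpNormedAlgebra

theorem SchurStable.exists_posSemidef_lyapunov_eq (hM : SchurStable M) (hW : W.PosSemidef) :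
    ∃ U : Matrix (Fin n) (Fin n) ℝ, U.PosSemidef ∧ W + Mᵀ * U * M = U := by
  have hsummable : Summable fun k => (M ^ k)ᵀ * W * M ^ k := by
    have hcont : Continuous fun N : Matrix (Fin n) (Fin n) ℝ => Nᵀ * W := by fun_prop
    obtain ⟨C, hC⟩ := ((hcont.tendsto 0).comp hM.tendsto_pow).norm.bddAbove_range
    refine .of_norm_bounded (hM.summable_norm_pow.mul_left C) fun k => (norm_mul_le _ _).trans ?_
    exact mul_le_mul_of_nonneg_right (hC ⟨k, rfl⟩) (norm_nonneg _)
  refine ⟨∑' k, (M ^ k)ᵀ * W * M ^ k, ?_, ?_⟩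
  · exact isClosed_setOf_posSemidef.mem_of_tendsto hsummable.hasSum
      (.of_forall fun s => posSemidef_sum s fun k _ => posSemidef_transpose_mul_mul hW _)
  · conv_rhs => rw [hsummable.tsum_eq_zero_add]
    simp only [pow_zero, pow_succ, transpose_mul, transpose_one, Matrix.one_mul, Matrix.mul_one]
    rw [← hsummable.tsum_mul_left, ← (hsummable.mul_left _).tsum_mul_right]
    simp only [Matrix.mul_assoc]

end Lyapunov

section RiccatiEquation

variable {n l : ℕ} {A : Matrix (Fin n) (Fin n) ℝ} {B : Matrix (Fin n) (Fin l) ℝ}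
  {Q Q₁ : Matrix (Fin n) (Fin n) ℝ} {R : Matrix (Fin l) (Fin l) ℝ}
  {P P' : Matrix (Fin n) (Fin n) ℝ}

theorem exists_isFixedPt_riccati_of_stabilizable (hQ : Q.PosSemidef) (hR : R.PosDef)
    (hAB : Stabilizable A B) :
    ∃ P : Matrix (Fin n) (Fin n) ℝ, P.PosSemidef ∧ Function.IsFixedPt (riccati A B Q R) P := by
  obtain ⟨F, hF⟩ := hAB
  obtain ⟨U, hU, hUF⟩ := hF.exists_posSemidef_lyapunov_eq
    (hQ.add (posSemidef_transpose_mul_mul hR.posSemidef F))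
  exact exists_isFixedPt_riccati hQ hR hU hUF.le

theorem mulVec_eq_zero_of_stageWeight {ι κ : Type*} [Fintype ι] [Fintype κ]
    {Q Q₁ : Matrix ι ι ℝ} {R : Matrix κ κ ℝ} (hR : R.PosDef)
    (hQ₁ : Q₁.PosSemidef) (hle : Q₁ ≤ Q) {K : Matrix κ ι ℝ} {x : ι → ℝ}
    (hx : (Q + Kᵀ * R * K) *ᵥ x = 0) : K *ᵥ x = 0 ∧ Q₁ *ᵥ x = 0 := by
  classical
  have hsum : x ⬝ᵥ Q *ᵥ x + (K *ᵥ x) ⬝ᵥ R *ᵥ (K *ᵥ x) = 0 := by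
    rw [← dotProduct_transpose_mul_mul_mulVec, ← dotProduct_add, ← add_mulVec, hx, dotProduct_zero]
  have hQ₁x : 0 ≤ x ⬝ᵥ Q₁ *ᵥ x := hQ₁.dotProduct_mulVec_nonneg x
  have hRKx : 0 ≤ (K *ᵥ x) ⬝ᵥ R *ᵥ (K *ᵥ x) := hR.posSemidef.dotProduct_mulVec_nonneg _
  have hQx := dotProduct_mulVec_mono hle x
  refine ⟨?_, (hQ₁.dotProduct_mulVec_zero_iff x).1 (by rw [star_trivial]; linarith)⟩
  by_contra hKx
  have := hR.dotProduct_mulVec_pos hKx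
  rw [star_trivial] at this
  linarith

theorem schurStable_of_isFixedPt_riccati (hR : R.PosDef) (hQ₁ : Q₁.PosSemidef) (hle : Q₁ ≤ Q)
    (hdet : Detectable A (CFC.sqrt Q₁)) (hP : P.PosSemidef)
    (hfix : Function.IsFixedPt (riccati A B Q R) P) :
    SchurStable (A + B * riccatiGain A B R P) := by
  obtain ⟨L, hL⟩ := hdet
  have hQ : Q.PosSemidef := Matrix.nonneg_iff_posSemidef.1 (hQ₁.nonneg.trans hle)
  refine schurStable_of_lyapunov_eq hL hP
    (hQ.add (posSemidef_transpose_mul_mul hR.posSemidef (riccatiGain A B R P)))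
    ((riccati_eq_closedLoopCost A B Q hR hP).symm.trans hfix) fun x hx => ?_
  obtain ⟨hKx, hQ₁x⟩ := mulVec_eq_zero_of_stageWeight hR hQ₁ hle hx
  simp only [add_mulVec, ← mulVec_mulVec, hKx, (sqrt_mulVec_eq_zero_iff hQ₁).2 hQ₁x, mulVec_zero]

theorem le_of_isFixedPt_riccati (hR : R.PosDef) (hP : P.PosSemidef) (hP' : P'.PosSemidef)
    (hfix : Function.IsFixedPt (riccati A B Q R) P)
    (hfix' : Function.IsFixedPt (riccati A B Q R) P')
    (hstable : SchurStable (A + B * riccatiGain A B R P')) : P ≤ P' := by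
  have hle : P ≤ closedLoopCost A B Q R (riccatiGain A B R P') P :=
    hfix.symm.trans_le (riccati_le_closedLoopCost A B Q hR hP _)
  have heq : P' = closedLoopCost A B Q R (riccatiGain A B R P') P' :=
    hfix'.symm.trans (riccati_eq_closedLoopCost A B Q hR hP')
  refine Matrix.le_iff.2 (hstable.posSemidef_of_transpose_mul_mul_le ?_)
  calc _ = closedLoopCost A B Q R (riccatiGain A B R P') P'
        - closedLoopCost A B Q R (riccatiGain A B R P') P := by
        rw [closedLoopCost, closedLoopCost, add_sub_add_left_eq_sub, Matrix.mul_sub, Matrix.sub_mul]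
    _ ≤ P' - P := sub_le_sub heq.ge hle

theorem existsUnique_isFixedPt_riccati (hR : R.PosDef) (hAB : Stabilizable A B)
    (hQ₁ : Q₁.PosSemidef) (hle : Q₁ ≤ Q) (hdet : Detectable A (CFC.sqrt Q₁)) :
    ∃! P : Matrix (Fin n) (Fin n) ℝ,
      P.PosSemidef ∧ Function.IsFixedPt (riccati A B Q R) P := by
  have hQ : Q.PosSemidef := Matrix.nonneg_iff_posSemidef.1 (hQ₁.nonneg.trans hle)
  have hstable {P} (hP : P.PosSemidef ∧ Function.IsFixedPt (riccati A B Q R) P) :=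
    schurStable_of_isFixedPt_riccati hR hQ₁ hle hdet hP.1 hP.2
  obtain ⟨P, hP⟩ := exists_isFixedPt_riccati_of_stabilizable hQ hR hAB
  exact ⟨P, hP, fun P' hP' => le_antisymm
    (le_of_isFixedPt_riccati hR hP'.1 hP.1 hP'.2 hP.2 (hstable hP))
    (le_of_isFixedPt_riccati hR hP.1 hP'.1 hP.2 hP'.2 (hstable hP'))⟩

end RiccatiEquation

section QuadraticMinimization

variable {𝕜 E : Type*} [Field 𝕜] [LinearOrder 𝕜] [IsStrictOrderedRing 𝕜] [AddCommGroup E]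
  [Module 𝕜 E] {b : LinearMap.BilinForm 𝕜 E} {V : Submodule 𝕜 E}

theorem exists_sub_mem_and_stationary [FiniteDimensional 𝕜 V]
    (hpos : ∀ v ∈ V, v ≠ 0 → 0 < b v v) (g : Module.Dual 𝕜 E) (p₀ : E) :
    ∃ p, p - p₀ ∈ V ∧ ∀ v ∈ V, 2 * b p v + g v = 0 := by
  let bV : V →ₗ[𝕜] Module.Dual 𝕜 V := b.domRestrict₁₂ V V
  have hinj : Function.Injective bV := (injective_iff_map_eq_zero bV).2 fun v hv => by
    by_contra hne
    exact (hpos v v.2 fun h => hne (Subtype.ext h)).ne' (LinearMap.congr_fun hv v)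
  obtain ⟨v, hv⟩ := (LinearMap.injective_iff_surjective_of_finrank_eq_finrank
    Subspace.dual_finrank_eq.symm).1 hinj (-(b p₀ + (2⁻¹ : 𝕜) • g).domRestrict V)
  refine ⟨p₀ + v, by simp, fun w hw => ?_⟩
  have hvw : b v w = -(b p₀ w + 2⁻¹ * g w) := LinearMap.congr_fun hv ⟨w, hw⟩
  rw [map_add, LinearMap.add_apply, hvw]
  ring

theorem bilin_add_dual_eq_of_stationary (hb : b.IsSymm) {g : Module.Dual 𝕜 E} {p q : E}
    (hp : 2 * b p (q - p) + g (q - p) = 0) :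
    b q q + g q = b p p + g p + b (q - p) (q - p) := by
  have hsymm : b q p = b p q := hb.eq q p
  simp only [map_sub, LinearMap.sub_apply, hsymm] at hp ⊢
  linear_combination hp

theorem existsUnique_minimizer_bilin_add_dual [FiniteDimensional 𝕜 V] (hb : b.IsSymm)
    (hpos : ∀ v ∈ V, v ≠ 0 → 0 < b v v) (g : Module.Dual 𝕜 E) (p₀ : E) :
    ∃! p, p - p₀ ∈ V ∧ ∀ q, q - p₀ ∈ V → b p p + g p ≤ b q q + g q := by
  obtain ⟨p, hp, hstat⟩ := exists_sub_mem_and_stationary hpos g p₀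
  have hmem {q} (hq : q - p₀ ∈ V) : q - p ∈ V := by simpa using V.sub_mem hq hp
  have hval {q} (hq : q - p₀ ∈ V) := bilin_add_dual_eq_of_stationary hb (hstat _ (hmem hq))
  refine ⟨p, ⟨hp, fun q hq => ?_⟩, fun q hq => ?_⟩
  · rw [hval hq, le_add_iff_nonneg_right]
    rcases eq_or_ne (q - p) 0 with h | h
    · simp [h]
    · exact (hpos _ (hmem hq) h).le
  · by_contra hne
    have := hq.2 p hp
    rw [hval hq.1] at this
    linarith [hpos _ (hmem hq.1) (sub_ne_zero.2 hne)]

end QuadraticMinimization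

namespace Data

section OptimalSteadyState

variable {n l m : ℕ} (D : Data n l m)

/-- The symmetric bilinear form whose quadratic form is the quadratic part of the deterministic
stage cost. -/
def costBilin : LinearMap.BilinForm ℝ ((Fin n → ℝ) × (Fin l → ℝ)) :=
  (Matrix.toBilin' D.Q₁).compl₁₂ (.fst ℝ _ _) (.fst ℝ _ _)
    + (Matrix.toBilin' D.R₁).compl₁₂ (.snd ℝ _ _) (.snd ℝ _ _)

/-- The linear part of the deterministic stage cost. -/
def costDual : Module.Dual ℝ ((Fin n → ℝ) × (Fin l → ℝ)) :=
  (dotProductEquiv ℝ (Fin n) D.s).coprod (dotProductEquiv ℝ (Fin l) D.v)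

/-- The linear map `(x, u) ↦ (I - A) x - B u`, whose fibres are the sets of steady states. -/
def steadyMap : (Fin n → ℝ) × (Fin l → ℝ) →ₗ[ℝ] Fin n → ℝ :=
  (1 - D.A).mulVecLin.coprod (-D.B).mulVecLin

theorem costBilin_apply (p q : (Fin n → ℝ) × (Fin l → ℝ)) :
    D.costBilin p q = p.1 ⬝ᵥ D.Q₁ *ᵥ q.1 + p.2 ⬝ᵥ D.R₁ *ᵥ q.2 := by
  simp [costBilin, Matrix.toBilin'_apply']

theorem isSymm_costBilin : D.costBilin.IsSymm := by
  refine ⟨fun p q => ?_⟩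
  rw [costBilin_apply, costBilin_apply,
    dotProduct_mulVec_comm_of_isSymm (isSymm_of_posSemidef D.posSemidef_Q₁),
    dotProduct_mulVec_comm_of_isSymm (isSymm_of_posSemidef D.posDef_R₁.posSemidef)]

theorem detCost_eq_costBilin_add_costDual (x : Fin n → ℝ) (u : Fin l → ℝ) :
    D.detCost x u = D.costBilin (x, u) (x, u) + D.costDual (x, u) + D.c := by
  rw [detCost, costBilin_apply, costDual, LinearMap.coprod_apply]
  simp only [dotProductEquiv_apply_apply]
  ring

theorem isSteadyState_iff_steadyMap {w : Fin m → ℝ} {p : (Fin n → ℝ) × (Fin l → ℝ)} :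
    D.IsSteadyState w p.1 p.2 ↔ D.steadyMap p = D.E *ᵥ w + D.z := by
  rw [IsSteadyState, steadyMap, LinearMap.coprod_apply, mulVecLin_apply, mulVecLin_apply,
    neg_mulVec, ← sub_eq_add_neg]

theorem costBilin_self_pos (hdet : Detectable D.A (CFC.sqrt D.Q₁))
    {p : (Fin n → ℝ) × (Fin l → ℝ)} (hp : D.steadyMap p = 0) (hne : p ≠ 0) :
    0 < D.costBilin p p := by
  have hQ : 0 ≤ p.1 ⬝ᵥ D.Q₁ *ᵥ p.1 := D.posSemidef_Q₁.dotProduct_mulVec_nonneg p.1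
  have hR : 0 ≤ p.2 ⬝ᵥ D.R₁ *ᵥ p.2 := D.posDef_R₁.posSemidef.dotProduct_mulVec_nonneg p.2
  rw [costBilin_apply]
  by_contra hle
  have hu : p.2 = 0 := by
    by_contra hu
    have := D.posDef_R₁.dotProduct_mulVec_pos hu
    rw [star_trivial] at this
    linarith
  have hQx : D.Q₁ *ᵥ p.1 = 0 := by
    refine (D.posSemidef_Q₁.dotProduct_mulVec_zero_iff p.1).1 ?_
    rw [star_trivial]
    linarith
  have hAx : D.A *ᵥ p.1 = p.1 := by
    rw [steadyMap, LinearMap.coprod_apply, mulVecLin_apply, mulVecLin_apply, hu, mulVec_zero,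
      add_zero, sub_mulVec, one_mulVec, sub_eq_zero] at hp
    exact hp.symm
  obtain ⟨L, hL⟩ := hdet
  have hx : p.1 = 0 := hL.eq_zero_of_mulVec_eq <| by
    rw [add_mulVec, ← mulVec_mulVec, (sqrt_mulVec_eq_zero_iff D.posSemidef_Q₁).2 hQx, mulVec_zero,
      add_zero, hAx]
  exact hne (Prod.ext hx hu)

theorem existsUnique_isOptimalSteadyState (hdet : Detectable D.A (CFC.sqrt D.Q₁))
    {w : Fin m → ℝ} (hsteady : ∃ x u, D.IsSteadyState w x u) :
    ∃! p : (Fin n → ℝ) × (Fin l → ℝ), D.IsOptimalSteadyState w p.1 p.2 := by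
  obtain ⟨x₀, u₀, h₀⟩ := hsteady
  rw [D.isSteadyState_iff_steadyMap (p := (x₀, u₀))] at h₀
  have hmem {p} : p - (x₀, u₀) ∈ LinearMap.ker D.steadyMap ↔ D.IsSteadyState w p.1 p.2 := by
    rw [LinearMap.sub_mem_ker_iff, h₀, isSteadyState_iff_steadyMap]
  have hopt (p : (Fin n → ℝ) × (Fin l → ℝ)) : D.IsOptimalSteadyState w p.1 p.2 ↔
      p - (x₀, u₀) ∈ LinearMap.ker D.steadyMap ∧ ∀ q, q - (x₀, u₀) ∈ LinearMap.ker D.steadyMap →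
        D.costBilin p p + D.costDual p ≤ D.costBilin q q + D.costDual q := by
    simp only [hmem, IsOptimalSteadyState, Prod.forall, detCost_eq_costBilin_add_costDual,
      add_le_add_iff_right]
  simp only [hopt]
  exact existsUnique_minimizer_bilin_add_dual D.isSymm_costBilin
    (fun _ => D.costBilin_self_pos hdet) D.costDual (x₀, u₀)

end OptimalSteadyState

end Data

section Moments

variable {Ω Ω' : Type*} [MeasurableSpace Ω] [MeasurableSpace Ω'] {μ : Measure Ω}

section MulVec

variable {ι κ : Type*} [Fintype ι] [Fintype κ] {X : Ω → ι → ℝ}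

theorem memLp_mulVec {p : ℝ≥0∞} (hX : MemLp X p μ) (M : Matrix κ ι ℝ) :
    MemLp (fun ω => M *ᵥ X ω) p μ :=
  M.mulVecLin.toContinuousLinearMap.comp_memLp' hX

theorem integral_mulVec (hX : Integrable X μ) (M : Matrix κ ι ℝ) :
    ∫ ω, M *ᵥ X ω ∂μ = M *ᵥ ∫ ω, X ω ∂μ :=
  M.mulVecLin.toContinuousLinearMap.integral_comp_comm hX

theorem integrable_dotProduct (hX : Integrable X μ) (c : ι → ℝ) :
    Integrable (fun ω => c ⬝ᵥ X ω) μ :=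
  (dotProductBilin ℝ ℝ c).toContinuousLinearMap.integrable_comp hX

theorem integral_dotProduct (hX : Integrable X μ) (c : ι → ℝ) :
    ∫ ω, c ⬝ᵥ X ω ∂μ = c ⬝ᵥ ∫ ω, X ω ∂μ :=
  (dotProductBilin ℝ ℝ c).toContinuousLinearMap.integral_comp_comm hX

theorem integrable_dotProduct_mulVec_self (hX : MemLp X 2 μ) (Q : Matrix ι ι ℝ) :
    Integrable (fun ω => X ω ⬝ᵥ Q *ᵥ X ω) μ :=
  integrable_finsetSum _ fun i _ => (hX.eval i).integrable_mul ((memLp_mulVec hX Q).eval i)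

end MulVec

variable {d : ℕ} {X Y : Ω → Fin d → ℝ}

theorem covMat_map {Z : Ω' → Ω} {ν : Measure Ω'} (hZ : AEMeasurable Z ν)
    (hX : AEStronglyMeasurable X (ν.map Z)) : covMat (ν.map Z) X = covMat ν (X ∘ Z) :=
  Matrix.ext fun i j => covariance_map ((continuous_apply i).comp_aestronglyMeasurable hX)
    ((continuous_apply j).comp_aestronglyMeasurable hX) hZ

theorem covMat_eq_of_identDistrib {ν : Measure Ω'} {Y : Ω' → Fin d → ℝ}
    (h : IdentDistrib X Y μ ν) : covMat μ X = covMat ν Y := by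
  have hX := covMat_map h.aemeasurable_fst (X := id) aestronglyMeasurable_id
  have hY := covMat_map h.aemeasurable_snd (X := id) aestronglyMeasurable_id
  exact (hX.symm.trans (by rw [h.map_eq])).trans hY

theorem covMat_add_const [IsProbabilityMeasure μ] (hX : Integrable X μ) (c : Fin d → ℝ) :
    covMat μ (fun ω => X ω + c) = covMat μ X := by
  ext i j
  simp only [covMat, of_apply, Pi.add_apply, covariance_add_const_left (hX.eval i),
    covariance_add_const_right (hX.eval j)]

theorem covMat_add_of_indepFun [IsProbabilityMeasure μ] (hXY : IndepFun X Y μ) (hX : MemLp X 2 μ)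
    (hY : MemLp Y 2 μ) : covMat μ (fun ω => X ω + Y ω) = covMat μ X + covMat μ Y := by
  ext i j
  have hcross (i j : Fin d) : cov[fun ω => X ω i, fun ω => Y ω j; μ] = 0 :=
    (hXY.comp (measurable_pi_apply i) (measurable_pi_apply j)).covariance_eq_zero (hX.eval i)
      (hY.eval j)
  simp only [covMat, of_apply, Pi.add_apply, Matrix.add_apply]
  change cov[(X · i) + (Y · i), (X · j) + (Y · j); μ] = _
  rw [covariance_add_left (hX.eval i) (hY.eval i) ((hX.eval j).add (hY.eval j)),
    covariance_add_right (hX.eval i) (hX.eval j) (hY.eval j),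
    covariance_add_right (hY.eval i) (hX.eval j) (hY.eval j), hcross, covariance_comm (Y · i),
    hcross, add_zero, zero_add]

theorem integral_dotProduct_mulVec_self [IsProbabilityMeasure μ] (hX : MemLp X 2 μ)
    (Q : Matrix (Fin d) (Fin d) ℝ) :
    ∫ ω, X ω ⬝ᵥ Q *ᵥ X ω ∂μ
      = (∫ ω, X ω ∂μ) ⬝ᵥ Q *ᵥ (∫ ω, X ω ∂μ) + (Q * covMat μ X).trace := by
  have hint (i : Fin d) : Integrable (fun ω => X ω i) μ := (hX.eval i).integrable one_le_two
  have hmul (i j : Fin d) : Integrable (fun ω => X ω i * (Q i j * X ω j)) μ :=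
    (hX.eval i).integrable_mul ((hX.eval j).const_mul _)
  have hcov (i j : Fin d) : ∫ ω, X ω i * (Q i j * X ω j) ∂μ
      = (∫ ω, X ω ∂μ) i * (Q i j * (∫ ω, X ω ∂μ) j) + Q i j * covMat μ X j i := by
    rw [covMat, of_apply, covariance_eq_sub (hX.eval j) (hX.eval i), eval_integral hint,
      eval_integral hint]
    simp only [mul_left_comm _ (Q i j), integral_const_mul, Pi.mul_apply, mul_comm (X _ i)]
    ring
  simp only [dotProduct, mulVec, Finset.mul_sum, trace, diag_apply, mul_apply]
  rw [integral_finsetSum _ fun i _ => integrable_finsetSum _ fun j _ => hmul i j]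
  simp only [integral_finsetSum _ fun j _ => hmul _ j, hcov, Finset.sum_add_distrib]

theorem trace_mul_covMat [IsProbabilityMeasure μ] (hX : MemLp X 2 μ)
    (Q : Matrix (Fin d) (Fin d) ℝ) : (Q * covMat μ X).trace
      = ∫ ω, (X ω - ∫ ω', X ω' ∂μ) ⬝ᵥ Q *ᵥ (X ω - ∫ ω', X ω' ∂μ) ∂μ := by
  have hX1 : Integrable X μ := hX.integrable one_le_two
  have hcov := covMat_add_const hX1 (-∫ ω', X ω' ∂μ)
  simp only [← sub_eq_add_neg] at hcov
  have hmean : ∫ ω, (X ω - ∫ ω', X ω' ∂μ) ∂μ = 0 := by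
    rw [integral_sub hX1 (integrable_const _), integral_const, probReal_univ, one_smul, sub_self]
  rw [integral_dotProduct_mulVec_self (X := fun ω => X ω - _) (hX.sub (memLp_const _)), hmean,
    zero_dotProduct, zero_add, hcov]

theorem trace_mul_covMat_nonneg [IsProbabilityMeasure μ] (hX : MemLp X 2 μ)
    {Q : Matrix (Fin d) (Fin d) ℝ} (hQ : Q.PosSemidef) : 0 ≤ (Q * covMat μ X).trace := by
  rw [trace_mul_covMat hX]
  exact integral_nonneg fun _ => hQ.dotProduct_mulVec_nonneg _

theorem ae_eq_integral_of_trace_mul_covMat_eq_zero [IsProbabilityMeasure μ] (hX : MemLp X 2 μ)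
    {Q : Matrix (Fin d) (Fin d) ℝ} (hQ : Q.PosDef) (h0 : (Q * covMat μ X).trace = 0) :
    ∀ᵐ ω ∂μ, X ω = ∫ ω', X ω' ∂μ := by
  rw [trace_mul_covMat hX] at h0
  have hzero := (integral_eq_zero_iff_of_nonneg
    (fun _ => hQ.posSemidef.dotProduct_mulVec_nonneg _)
    (integrable_dotProduct_mulVec_self (hX.sub (memLp_const _)) Q)).1 h0
  filter_upwards [hzero] with ω hω
  by_contra hne
  exact (hQ.dotProduct_mulVec_pos (sub_ne_zero.2 hne)).ne' hω

theorem trace_covMat_add_eq_riccati_add [IsProbabilityMeasure μ] {a b : ℕ}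
    {X : Ω → Fin a → ℝ} {U : Ω → Fin b → ℝ} (hX : MemLp X 2 μ) (hU : MemLp U 2 μ)
    (A : Matrix (Fin a) (Fin a) ℝ) (B : Matrix (Fin a) (Fin b) ℝ)
    (Q : Matrix (Fin a) (Fin a) ℝ) {R : Matrix (Fin b) (Fin b) ℝ} (hR : R.PosDef)
    {P : Matrix (Fin a) (Fin a) ℝ} (hP : P.PosSemidef) :
    (Q * covMat μ X).trace + (R * covMat μ U).trace
        + (P * covMat μ (fun ω => A *ᵥ X ω + B *ᵥ U ω)).trace
      = (riccati A B Q R P * covMat μ X).trace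
        + ((R + Bᵀ * P * B) * covMat μ (fun ω => U ω - riccatiGain A B R P *ᵥ X ω)).trace := by
  have hX1 : Integrable X μ := hX.integrable one_le_two
  have hU1 : Integrable U μ := hU.integrable one_le_two
  have hY : MemLp (fun ω => A *ᵥ X ω + B *ᵥ U ω) 2 μ :=
    (memLp_mulVec hX A).add (memLp_mulVec hU B)
  have hZ : MemLp (fun ω => U ω - riccatiGain A B R P *ᵥ X ω) 2 μ :=
    hU.sub (memLp_mulVec hX _)
  have hmeanY : ∫ ω, (A *ᵥ X ω + B *ᵥ U ω) ∂μ = A *ᵥ ∫ ω, X ω ∂μ + B *ᵥ ∫ ω, U ω ∂μ := by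
    rw [integral_add ((memLp_mulVec hX A).integrable one_le_two)
      ((memLp_mulVec hU B).integrable one_le_two), integral_mulVec hX1, integral_mulVec hU1]
  have hmeanZ : ∫ ω, (U ω - riccatiGain A B R P *ᵥ X ω) ∂μ
      = ∫ ω, U ω ∂μ - riccatiGain A B R P *ᵥ ∫ ω, X ω ∂μ := by
    rw [integral_sub hU1 ((memLp_mulVec hX _).integrable one_le_two), integral_mulVec hX1]
  have hQX := integrable_dotProduct_mulVec_self hX Q
  have hRU := integrable_dotProduct_mulVec_self hU R
  have hsquare := integral_congr_ae (ae_of_all μ fun ω =>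
    quadraticForm_add_eq_riccati_add A B Q hR hP (X ω) (U ω))
  rw [integral_add (hQX.fun_add hRU) (integrable_dotProduct_mulVec_self hY P),
    integral_add hQX hRU, integral_add (integrable_dotProduct_mulVec_self hX _)
      (integrable_dotProduct_mulVec_self hZ _)] at hsquare
  simp only [integral_dotProduct_mulVec_self hX, integral_dotProduct_mulVec_self hU,
    integral_dotProduct_mulVec_self hY, integral_dotProduct_mulVec_self hZ, hmeanY, hmeanZ]
    at hsquare
  linear_combination hsquare
    - quadraticForm_add_eq_riccati_add A B Q hR hP (∫ ω, X ω ∂μ) (∫ ω, U ω ∂μ)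

end Moments

section StationaryLaw

variable {E : Type*} [NormedAddCommGroup E] [NormedSpace ℝ E]

section Uniqueness

variable [MeasurableSpace E] [BorelSpace E]

theorem tendsto_charFunDual_comp_of_tendsto {ϱ : Measure E} [IsProbabilityMeasure ϱ]
    {T : ℕ → E →L[ℝ] E} (hT : ∀ x, Tendsto (fun k => T k x) atTop (𝓝 0)) (L : StrongDual ℝ E) :
    Tendsto (fun k => charFunDual ϱ (L ∘SL T k)) atTop (𝓝 1) := by
  have hlim : Tendsto (fun k => ∫ x, Complex.exp (L (T k x) * Complex.I) ∂ϱ) atTop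
      (𝓝 (∫ _, 1 ∂ϱ)) := by
    refine tendsto_integral_of_dominated_convergence (fun _ => (1 : ℝ))
      (fun k => Continuous.aestronglyMeasurable (by fun_prop)) (integrable_const _)
      (fun k => ae_of_all _ fun x => (Complex.norm_exp_ofReal_mul_I _).le)
      (ae_of_all _ fun x => ?_)
    have hcont : Continuous fun y => Complex.exp (L y * Complex.I) := by fun_prop
    simpa [Function.comp_def] using (hcont.tendsto 0).comp (hT x)
  simpa [charFunDual_apply] using hlim

theorem norm_charFunDual_le_one (ν : Measure E) [IsProbabilityMeasure ν] (L : StrongDual ℝ E) :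
    ‖charFunDual ν L‖ ≤ 1 := by
  have := Measure.isProbabilityMeasure_map (μ := ν) L.measurable.aemeasurable
  rw [charFunDual_eq_charFun_map_one]
  exact norm_charFun_le_one _

variable [SecondCountableTopology E] [CompleteSpace E]

theorem eq_of_map_conv_eq {T : E →L[ℝ] E}
    (hT : ∀ x, Tendsto (fun k => (T ^ k) x) atTop (𝓝 0)) {ν ϱ₁ ϱ₂ : Measure E}
    [IsProbabilityMeasure ν] [IsProbabilityMeasure ϱ₁] [IsProbabilityMeasure ϱ₂]
    (h₁ : ϱ₁.map T ∗ ν = ϱ₁) (h₂ : ϱ₂.map T ∗ ν = ϱ₂) : ϱ₁ = ϱ₂ := by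
  refine Measure.ext_of_charFunDual (funext fun L => ?_)
  have hfactor {ϱ : Measure E} [IsProbabilityMeasure ϱ] (h : ϱ.map T ∗ ν = ϱ)
      (L : StrongDual ℝ E) : charFunDual ϱ L = charFunDual ϱ (L ∘SL T) * charFunDual ν L := by
    rw [← charFunDual_map, ← charFunDual_conv, h]
  have hle (k : ℕ) : ‖charFunDual ϱ₁ L - charFunDual ϱ₂ L‖
      ≤ ‖charFunDual ϱ₁ (L ∘SL (T ^ k)) - charFunDual ϱ₂ (L ∘SL (T ^ k))‖ := by
    induction k with
    | zero => exact le_rfl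
    | succ k ih =>
      refine ih.trans ?_
      rw [hfactor h₁ (L ∘SL (T ^ k)), hfactor h₂ (L ∘SL (T ^ k)), ← sub_mul, norm_mul, pow_succ]
      exact mul_le_of_le_one_right (norm_nonneg _) (norm_charFunDual_le_one ν _)
  have hlim := ((tendsto_charFunDual_comp_of_tendsto (ϱ := ϱ₁) hT L).sub
    (tendsto_charFunDual_comp_of_tendsto (ϱ := ϱ₂) hT L)).norm
  rw [sub_self, norm_zero] at hlim
  exact sub_eq_zero.1 (norm_le_zero_iff.1 (ge_of_tendsto' hlim hle))

end Uniqueness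

section Existence

variable {Ω : Type*} [MeasurableSpace Ω] {μ : Measure Ω}

theorem indepFun_process_of_notMem_range {ι κ : Type*} {β : ι → Type*}
    [∀ i, MeasurableSpace (β i)] {f : ∀ i, Ω → β i} (hf : iIndepFun f μ)
    (hmeas : ∀ i, AEMeasurable (f i) μ) {g : κ → ι} {i : ι} (hi : i ∉ Set.range g) :
    IndepFun (fun ω k => f (g k) ω) (f i) μ := by
  classical
  have := hf.isProbabilityMeasure
  refine IndepFun.process_indepFun₀ (fun k => hmeas (g k)) (hmeas i) fun I => ?_
  have hdisj : Disjoint (I.image g) {i} := by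
    rw [Finset.disjoint_singleton_right, Finset.mem_image]
    rintro ⟨k, -, hk⟩
    exact hi ⟨k, hk⟩
  exact (hf.indepFun_finset₀ _ _ hdisj hmeas).comp
    (φ := fun (x : ∀ j : I.image g, β j) (k : I) => x ⟨g k, Finset.mem_image_of_mem g k.2⟩)
    (ψ := fun (y : ∀ j : ({i} : Finset ι), β j) => y ⟨i, Finset.mem_singleton_self i⟩)
    (by fun_prop) (by fun_prop)

theorem memLp_tsum {p : ℝ≥0∞} [Fact (1 ≤ p)] {F : Type*} [NormedAddCommGroup F] [CompleteSpace F]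
    {f : ℕ → Ω → F} (hf : ∀ k, MemLp (f k) p μ) (hsum : ∑' k, eLpNorm (f k) p μ ≠ ∞) :
    MemLp (fun ω => ∑' k, f k ω) p μ := by
  have hsum' : ∑' k, ‖(hf k).toLp (f k)‖ₑ ≠ ∞ := by simpa only [Lp.enorm_toLp] using hsum
  refine (Lp.memLp (∑' k, (hf k).toLp (f k))).ae_eq ?_
  filter_upwards [Lp.coeFn_tsum hsum', ae_all_iff.2 fun k => (hf k).coeFn_toLp] with ω h1 h2
  rw [h1]
  exact tsum_congr h2

/-- The state at time `0` of the recursion `x⁺ = T x + w` started in the infinite past, where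
`w k` is the noise that entered `k + 1` time steps ago. -/
noncomputable def noiseSeries (T : E →L[ℝ] E) (w : ℕ → E) : E :=
  ∑' k, (T ^ k) (w k)

theorem apply_noiseSeries_succ_add {T : E →L[ℝ] E} {w : ℕ → E}
    (hw : Summable fun k => (T ^ k) (w (k + 1))) :
    T (noiseSeries T fun k => w (k + 1)) + w 0 = noiseSeries T w := by
  have hT (k : ℕ) : T ((T ^ k) (w (k + 1))) = (T ^ (k + 1)) (w (k + 1)) := by
    rw [pow_succ']
    rfl
  have hsum : Summable fun k => (T ^ k) (w k) :=
    (summable_nat_add_iff 1).1 (by simpa only [hT] using T.summable hw)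
  rw [noiseSeries, noiseSeries, T.map_tsum hw, hsum.tsum_eq_zero_add, add_comm, pow_zero]
  simp only [hT, one_apply_eq_self]

variable {p : ℝ≥0∞} {T : E →L[ℝ] E} {W : ℕ → Ω → E} {C : ℝ≥0∞}

theorem tsum_eLpNorm_pow_apply_ne_top (hT : Summable fun k => ‖T ^ k‖) (hC : C ≠ ∞)
    (hle : ∀ k, eLpNorm (W k) p μ ≤ C) : ∑' k, eLpNorm (fun ω => (T ^ k) (W k ω)) p μ ≠ ∞ := by
  have hterm (k : ℕ) : eLpNorm (fun ω => (T ^ k) (W k ω)) p μ ≤ ENNReal.ofReal ‖T ^ k‖ * C :=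
    (eLpNorm_le_mul_eLpNorm_of_ae_le_mul (ae_of_all _ fun ω => (T ^ k).le_opNorm (W k ω)) p).trans
      (by gcongr; exact hle k)
  refine ne_top_of_le_ne_top ?_ (ENNReal.tsum_le_tsum hterm)
  rw [ENNReal.tsum_mul_right]
  exact ENNReal.mul_ne_top hT.tsum_ofReal_ne_top hC

variable [CompleteSpace E] [hp : Fact (1 ≤ p)]

theorem ae_summable_pow_apply (hT : Summable fun k => ‖T ^ k‖)
    (hW : ∀ k, MemLp (W k) p μ) (hC : C ≠ ∞) (hle : ∀ k, eLpNorm (W k) p μ ≤ C) :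
    ∀ᵐ ω ∂μ, Summable fun k => (T ^ k) (W k ω) := by
  filter_upwards [summable_norm_of_tsum_eLpNorm_ne_top hp.out
    (fun k => ((T ^ k).comp_memLp' (hW k)).1) (tsum_eLpNorm_pow_apply_ne_top hT hC hle)] with ω hω
  exact hω.of_norm

theorem memLp_noiseSeries (hT : Summable fun k => ‖T ^ k‖)
    (hW : ∀ k, MemLp (W k) p μ) (hC : C ≠ ∞) (hle : ∀ k, eLpNorm (W k) p μ ≤ C) :
    MemLp (fun ω => noiseSeries T fun k => W k ω) p μ :=
  memLp_tsum (fun k => (T ^ k).comp_memLp' (hW k)) (tsum_eLpNorm_pow_apply_ne_top hT hC hle)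

variable [MeasurableSpace E] [BorelSpace E] [SecondCountableTopology E]

theorem measurable_noiseSeries (T : E →L[ℝ] E) : Measurable (noiseSeries T) :=
  Measurable.tsum fun k => (T ^ k).measurable.comp (measurable_pi_apply k)

theorem identDistrib_apply_noiseSeries_add (hT : Summable fun k => ‖T ^ k‖)
    (hindep : iIndepFun W μ) (hident : ∀ k, IdentDistrib (W k) (W 0) μ μ)
    (hW : MemLp (W 0) p μ) :
    IdentDistrib (fun ω => T (noiseSeries T fun k => W (k + 1) ω) + W 0 ω)
      (fun ω => noiseSeries T fun k => W (k + 1) ω) μ μ := by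
  have hsummable : ∀ᵐ ω ∂μ, Summable fun k => (T ^ k) (W (k + 1) ω) :=
    ae_summable_pow_apply hT (fun k => (hident (k + 1)).memLp_iff.2 hW) hW.2.ne
      fun k => (hident (k + 1)).eLpNorm_eq p |>.le
  have hnext : (fun ω => T (noiseSeries T fun k => W (k + 1) ω) + W 0 ω)
      =ᵐ[μ] fun ω => noiseSeries T fun k => W k ω := by
    filter_upwards [hsummable] with ω hω
    exact apply_noiseSeries_succ_add (w := (W · ω)) hω
  have hshift : IdentDistrib (fun ω k => W k ω) (fun ω k => W (k + 1) ω) μ μ :=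
    IdentDistrib.pi (fun k => (hident k).trans (hident (k + 1)).symm) hindep
      (hindep.precomp (add_left_injective 1))
  have hmeas : AEMeasurable (fun ω => noiseSeries T fun k => W k ω) μ :=
    (measurable_noiseSeries T).comp_aemeasurable hshift.aemeasurable_fst
  exact (IdentDistrib.of_ae_eq (hmeas.congr hnext.symm) hnext).trans
    (hshift.comp (measurable_noiseSeries T))

end Existence

end StationaryLaw

namespace Data

variable {n l m : ℕ} {D : Data n l m}

section Riccati

variable {P : Matrix (Fin n) (Fin n) ℝ}

theorem isRiccatiSolution_iff : D.IsRiccatiSolution P ↔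
    P.PosSemidef ∧ Function.IsFixedPt (riccati D.A D.B (D.Q₁ + D.Q₂) (D.R₁ + D.R₂)) P :=
  and_congr_right fun _ => eq_comm

theorem posDef_add_R : (D.R₁ + D.R₂).PosDef :=
  D.posDef_R₁.add_posSemidef D.posSemidef_R₂

theorem Q₁_le_add : D.Q₁ ≤ D.Q₁ + D.Q₂ :=
  le_add_of_nonneg_right D.posSemidef_Q₂.nonneg

theorem existsUnique_isRiccatiSolution (hdet : Detectable D.A (CFC.sqrt D.Q₁)) :
    ∃! P, D.IsRiccatiSolution P := by
  simp only [isRiccatiSolution_iff]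
  exact existsUnique_isFixedPt_riccati posDef_add_R D.stabilizable D.posSemidef_Q₁ Q₁_le_add hdet

theorem IsRiccatiSolution.schurStable (hP : D.IsRiccatiSolution P)
    (hdet : Detectable D.A (CFC.sqrt D.Q₁)) : SchurStable (D.A + D.B * D.gain P) :=
  schurStable_of_isFixedPt_riccati posDef_add_R D.posSemidef_Q₁ Q₁_le_add hdet hP.1
    (isRiccatiSolution_iff.1 hP).2

end Riccati

variable {Ω : Type*} [MeasurableSpace Ω] {μ : Measure Ω} {ϱW : Measure (Fin m → ℝ)}
  {ϱ ϱ' : Measure (Fin n → ℝ)} {π : (Fin n → ℝ) → (Fin l → ℝ)}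
  {P : Matrix (Fin n) (Fin n) ℝ} {xs : Fin n → ℝ} {us : Fin l → ℝ}
  {X : Ω → Fin n → ℝ} {V : Ω → Fin m → ℝ}

section Cost

theorem stageCost_eq_detCost_add_trace_covMat [IsProbabilityMeasure μ] {U : Ω → Fin l → ℝ}
    (hX : MemLp X 2 μ) (hU : MemLp U 2 μ) :
    D.stageCost μ X U = D.detCost (∫ ω, X ω ∂μ) (∫ ω, U ω ∂μ)
      + (((D.Q₁ + D.Q₂) * covMat μ X).trace + ((D.R₁ + D.R₂) * covMat μ U).trace) := by
  have hX1 : Integrable X μ := hX.integrable one_le_two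
  have hU1 : Integrable U μ := hU.integrable one_le_two
  have hQ := integrable_dotProduct_mulVec_self hX D.Q₁
  have hR := integrable_dotProduct_mulVec_self hU D.R₁
  have hs := integrable_dotProduct hX1 D.s
  have hv := integrable_dotProduct hU1 D.v
  rw [stageCost, integral_add (((hQ.fun_add hR).fun_add hs).fun_add hv) (integrable_const _),
    integral_add ((hQ.fun_add hR).fun_add hs) hv, integral_add (hQ.fun_add hR) hs,
    integral_add hQ hR, integral_dotProduct_mulVec_self hX, integral_dotProduct_mulVec_self hU,
    integral_dotProduct hX1, integral_dotProduct hU1, integral_const, probReal_univ, one_smul,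
    detCost, Matrix.add_mul, Matrix.add_mul, trace_add, trace_add]
  ring

/-- The part of the stage cost that is caused by the noise and does not depend on the
decision. -/
noncomputable def noiseCost (D : Data n l m) (ϱW : Measure (Fin m → ℝ))
    (P : Matrix (Fin n) (Fin n) ℝ) : ℝ :=
  (P * covMat ϱW (fun w => D.E *ᵥ w)).trace

/-- The excess of the stage cost of the state `X` and the input `U` over the cost of the linear
feedback with the Riccati gain. -/
noncomputable def gainPenalty (D : Data n l m) (μ : Measure Ω) (P : Matrix (Fin n) (Fin n) ℝ)
    (X : Ω → Fin n → ℝ) (U : Ω → Fin l → ℝ) : ℝ :=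
  ((D.R₁ + D.R₂ + D.Bᵀ * P * D.B) * covMat μ (fun ω => U ω - D.gain P *ᵥ X ω)).trace

theorem gainPenalty_nonneg [IsProbabilityMeasure μ] {U : Ω → Fin l → ℝ} (hP : P.PosSemidef)
    (hX : MemLp X 2 μ) (hU : MemLp U 2 μ) : 0 ≤ D.gainPenalty μ P X U :=
  trace_mul_covMat_nonneg (hU.sub (memLp_mulVec hX _))
    (posDef_add_transpose_mul_mul D.B posDef_add_R hP).posSemidef

theorem ae_eq_optFeedback_of_gainPenalty_eq_zero [IsProbabilityMeasure μ] {U : Ω → Fin l → ℝ}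
    (hP : P.PosSemidef) (hX : MemLp X 2 μ) (hU : MemLp U 2 μ)
    (h0 : D.gainPenalty μ P X U = 0) :
    U =ᵐ[μ] D.optFeedback P (∫ ω, X ω ∂μ) (∫ ω, U ω ∂μ) ∘ X := by
  have hKX := memLp_mulVec hX (D.gain P)
  have hae := ae_eq_integral_of_trace_mul_covMat_eq_zero (hU.sub hKX)
    (posDef_add_transpose_mul_mul D.B posDef_add_R hP) h0
  simp only [Pi.sub_apply] at hae
  rw [integral_sub (hU.integrable one_le_two) (hKX.integrable one_le_two),
    integral_mulVec (hX.integrable one_le_two)] at hae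
  filter_upwards [hae] with ω hω
  rw [Function.comp_apply, optFeedback, mulVec_sub, sub_add_comm, ← hω]
  abel

theorem gainPenalty_optFeedback [IsProbabilityMeasure μ] :
    D.gainPenalty μ P X (D.optFeedback P xs us ∘ X) = 0 := by
  have hconst (ω : Ω) :
      (D.optFeedback P xs us ∘ X) ω - D.gain P *ᵥ X ω = us - D.gain P *ᵥ xs := by
    rw [Function.comp_apply, optFeedback, mulVec_sub]
    abel
  have hcov : covMat μ (fun _ : Ω => us - D.gain P *ᵥ xs) = 0 :=
    Matrix.ext fun i j => covariance_const_left _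
  rw [gainPenalty]
  simp only [hconst, hcov, Matrix.mul_zero, trace_zero]

end Cost

section Witness

theorem IsWitness.memLp_input (h : D.IsWitness μ ϱW ϱ π X V) : MemLp (π ∘ X) 2 μ :=
  h.feedback.2 X h.memLp_state

theorem IsWitness.identDistrib_next [IsFiniteMeasure μ] (h : D.IsWitness μ ϱW ϱ π X V) :
    IdentDistrib (fun ω => D.f (X ω) (π (X ω)) (V ω)) X μ μ where
  aemeasurable_fst := ((((memLp_mulVec h.memLp_state D.A).add
    (memLp_mulVec h.memLp_input D.B)).add (memLp_mulVec h.memLp_noise D.E)).add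
      (memLp_const D.z)).aemeasurable
  aemeasurable_snd := h.memLp_state.aemeasurable
  map_eq := h.law_next.trans h.law_state.symm

theorem IsWitness.isSteadyState [IsProbabilityMeasure μ] (h : D.IsWitness μ ϱW ϱ π X V) :
    D.IsSteadyState (∫ w, w ∂ϱW) (∫ ω, X ω ∂μ) (∫ ω, π (X ω) ∂μ) := by
  have hX : Integrable X μ := h.memLp_state.integrable one_le_two
  have hU : Integrable (fun ω => π (X ω)) μ := h.memLp_input.integrable one_le_two
  have hV : Integrable V μ := h.memLp_noise.integrable one_le_two
  have hA := (memLp_mulVec h.memLp_state D.A).integrable one_le_two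
  have hB : Integrable (fun ω => D.B *ᵥ π (X ω)) μ :=
    (memLp_mulVec h.memLp_input D.B).integrable one_le_two
  have hE := (memLp_mulVec h.memLp_noise D.E).integrable one_le_two
  have hnoise : ∫ w, w ∂ϱW = ∫ ω, V ω ∂μ := by
    rw [← h.law_noise]
    exact integral_map hV.aemeasurable aestronglyMeasurable_id
  have hmean : ∫ ω, X ω ∂μ = D.f (∫ ω, X ω ∂μ) (∫ ω, π (X ω) ∂μ) (∫ w, w ∂ϱW) := by
    refine h.identDistrib_next.integral_eq.symm.trans ?_
    simp only [f]
    rw [integral_add ((hA.fun_add hB).fun_add hE) (integrable_const _),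
      integral_add (hA.fun_add hB) hE, integral_add hA hB, integral_mulVec hX,
      integral_mulVec hU, integral_mulVec hV, hnoise, integral_const, probReal_univ, one_smul]
  rw [IsSteadyState, sub_mulVec, one_mulVec]
  nth_rw 1 [hmean]
  rw [f]
  abel

theorem IsWitness.covMat_state [IsProbabilityMeasure μ] (h : D.IsWitness μ ϱW ϱ π X V) :
    covMat μ X = covMat μ (fun ω => D.A *ᵥ X ω + D.B *ᵥ π (X ω))
      + covMat ϱW (fun w => D.E *ᵥ w) := by
  have hAB : MemLp (fun ω => D.A *ᵥ X ω + D.B *ᵥ π (X ω)) 2 μ :=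
    (memLp_mulVec h.memLp_state D.A).add (memLp_mulVec h.memLp_input D.B)
  have hE := memLp_mulVec h.memLp_noise D.E
  have hπ := h.feedback.1
  have hindep : IndepFun (fun ω => D.A *ᵥ X ω + D.B *ᵥ π (X ω)) (fun ω => D.E *ᵥ V ω) μ :=
    h.indep.comp (φ := fun x => D.A *ᵥ x + D.B *ᵥ π x) (ψ := fun w => D.E *ᵥ w) (by fun_prop)
      (by fun_prop)
  have hsum : Integrable (fun ω => D.A *ᵥ X ω + D.B *ᵥ π (X ω) + D.E *ᵥ V ω) μ :=
    (hAB.add hE).integrable one_le_two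
  have hnoise : covMat ϱW (fun w => D.E *ᵥ w) = covMat μ (fun ω => D.E *ᵥ V ω) := by
    rw [← h.law_noise, covMat_map h.memLp_noise.aemeasurable (by fun_prop)]
    rfl
  rw [hnoise, ← covMat_add_of_indepFun hindep hAB hE, ← covMat_add_const hsum D.z]
  exact (covMat_eq_of_identDistrib h.identDistrib_next).symm

theorem IsWitness.stageCost_eq [IsProbabilityMeasure μ] (h : D.IsWitness μ ϱW ϱ π X V)
    (hP : D.IsRiccatiSolution P) :
    D.stageCost μ X (π ∘ X) = D.detCost (∫ ω, X ω ∂μ) (∫ ω, π (X ω) ∂μ) + D.noiseCost ϱW P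
      + D.gainPenalty μ P X (π ∘ X) := by
  have hinv : (P * covMat μ X).trace
      = (P * covMat μ (fun ω => D.A *ᵥ X ω + D.B *ᵥ π (X ω))).trace + D.noiseCost ϱW P := by
    rw [h.covMat_state, Matrix.mul_add, trace_add, noiseCost]
  have hsquare := trace_covMat_add_eq_riccati_add h.memLp_state h.memLp_input D.A D.B
    (D.Q₁ + D.Q₂) (posDef_add_R (D := D)) hP.1
  rw [(isRiccatiSolution_iff.1 hP).2.eq] at hsquare
  rw [stageCost_eq_detCost_add_trace_covMat h.memLp_state h.memLp_input, gainPenalty]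
  simp only [Function.comp_apply] at hsquare ⊢
  change _ = _ + ((D.R₁ + D.R₂ + D.Bᵀ * P * D.B)
    * covMat μ (fun ω => π (X ω) - riccatiGain D.A D.B (D.R₁ + D.R₂) P *ᵥ X ω)).trace
  linear_combination hsquare + hinv

theorem IsWitness.detCost_add_noiseCost_le_stageCost [IsProbabilityMeasure μ]
    (h : D.IsWitness μ ϱW ϱ π X V) (hP : D.IsRiccatiSolution P)
    (hopt : D.IsOptimalSteadyState (∫ w, w ∂ϱW) xs us) :
    D.detCost xs us + D.noiseCost ϱW P ≤ D.stageCost μ X (π ∘ X) := by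
  have hdet := hopt.2 _ _ h.isSteadyState
  have hpenalty : 0 ≤ D.gainPenalty μ P X (π ∘ X) :=
    gainPenalty_nonneg hP.1 h.memLp_state h.memLp_input
  rw [h.stageCost_eq hP]
  linarith

theorem isFeedback_optFeedback [IsFiniteMeasure μ] : IsFeedback μ (D.optFeedback P xs us) := by
  refine ⟨?_, fun X hX => ?_⟩
  · unfold optFeedback
    fun_prop
  · have hsub : MemLp (fun ω => X ω - xs) 2 μ := hX.sub (memLp_const xs)
    exact (memLp_mulVec hsub (D.gain P)).add (memLp_const us)

theorem IsWitness.optFeedback_of_stageCost_le [IsProbabilityMeasure μ]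
    (h : D.IsWitness μ ϱW ϱ π X V) (hP : D.IsRiccatiSolution P)
    (huniq : ∃! p : (Fin n → ℝ) × (Fin l → ℝ), D.IsOptimalSteadyState (∫ w, w ∂ϱW) p.1 p.2)
    (hopt : D.IsOptimalSteadyState (∫ w, w ∂ϱW) xs us)
    (hle : D.stageCost μ X (π ∘ X) ≤ D.detCost xs us + D.noiseCost ϱW P) :
    D.IsWitness μ ϱW ϱ (D.optFeedback P xs us) X V := by
  have hdet := hopt.2 _ _ h.isSteadyState
  have hpenalty : 0 ≤ D.gainPenalty μ P X (π ∘ X) :=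
    gainPenalty_nonneg hP.1 h.memLp_state h.memLp_input
  rw [h.stageCost_eq hP] at hle
  have hmeans : (∫ ω, X ω ∂μ, ∫ ω, π (X ω) ∂μ) = (xs, us) :=
    huniq.unique ⟨h.isSteadyState, fun x u hxu => by linarith [hopt.2 x u hxu]⟩ hopt
  have hae := ae_eq_optFeedback_of_gainPenalty_eq_zero hP.1 h.memLp_state h.memLp_input
    (by linarith)
  simp only [Function.comp_apply, (Prod.mk.inj hmeans).1, (Prod.mk.inj hmeans).2] at hae
  refine { h with feedback := isFeedback_optFeedback, law_next := ?_ }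
  rw [← h.law_next]
  refine Measure.map_congr ?_
  filter_upwards [hae] with ω hω
  rw [← Function.comp_apply (f := π), hω, Function.comp_apply]

end Witness

section OptFeedback

theorem IsFeasible.memP2 [IsProbabilityMeasure μ] (h : D.IsFeasible μ ϱW ϱ π) : MemP2 ϱ := by
  obtain ⟨X, V, h⟩ := h
  have hX := h.memLp_state.aemeasurable
  refine ⟨h.law_state ▸ Measure.isProbabilityMeasure_map hX, ?_⟩
  rw [← h.law_state, lintegral_map' (by fun_prop) hX]
  simpa using lintegral_rpow_enorm_lt_top_of_eLpNorm_lt_top two_ne_zero ENNReal.ofNat_ne_top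
    h.memLp_state.2

/-- The linear part of the dynamics under the optimal feedback. -/
noncomputable def closedLoopMap (D : Data n l m) (P : Matrix (Fin n) (Fin n) ℝ) :
    (Fin n → ℝ) →L[ℝ] (Fin n → ℝ) :=
  (D.A + D.B * D.gain P).mulVecLin.toContinuousLinearMap

/-- The affine part of the dynamics under the optimal feedback, including the noise. -/
noncomputable def closedLoopNoise (D : Data n l m) (P : Matrix (Fin n) (Fin n) ℝ) (xs : Fin n → ℝ)
    (us : Fin l → ℝ) (w : Fin m → ℝ) : Fin n → ℝ :=
  D.f 0 (D.optFeedback P xs us 0) w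

theorem f_optFeedback (x : Fin n → ℝ) (w : Fin m → ℝ) :
    D.f x (D.optFeedback P xs us x) w = D.closedLoopMap P x + D.closedLoopNoise P xs us w := by
  change _ = (D.A + D.B * D.gain P) *ᵥ x + _
  simp only [closedLoopNoise, f, optFeedback, add_mulVec, mulVec_add, mulVec_sub, ← mulVec_mulVec,
    mulVec_zero]
  abel

theorem measurable_closedLoopNoise : Measurable (D.closedLoopNoise P xs us) := by
  unfold closedLoopNoise f
  fun_prop

theorem memLp_closedLoopNoise [IsFiniteMeasure μ] {p : ℝ≥0∞} (hV : MemLp V p μ) :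
    MemLp (fun ω => D.closedLoopNoise P xs us (V ω)) p μ :=
  ((memLp_const (D.A *ᵥ 0 + D.B *ᵥ D.optFeedback P xs us 0)).add (memLp_mulVec hV D.E)).add
    (memLp_const D.z)

theorem summable_norm_closedLoopMap_pow (hst : SchurStable (D.A + D.B * D.gain P)) :
    Summable fun k => ‖D.closedLoopMap P ^ k‖ :=
  hst.summable_norm_mulVecLin_pow

theorem integral_optFeedback [IsProbabilityMeasure μ] (hX : Integrable X μ) :
    ∫ ω, D.optFeedback P xs us (X ω) ∂μ = D.optFeedback P xs us (∫ ω, X ω ∂μ) := by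
  have hsub : Integrable (fun ω => X ω - xs) μ := hX.sub (integrable_const xs)
  have hgain : Integrable (fun ω => D.gain P *ᵥ (X ω - xs)) μ :=
    (D.gain P).mulVecLin.toContinuousLinearMap.integrable_comp hsub
  simp only [optFeedback]
  rw [integral_add hgain (integrable_const us), integral_mulVec hsub,
    integral_sub hX (integrable_const xs)]
  simp only [integral_const, probReal_univ, one_smul]

theorem IsWitness.integral_state_of_optFeedback [IsProbabilityMeasure μ]
    (h : D.IsWitness μ ϱW ϱ (D.optFeedback P xs us) X V)
    (hst : SchurStable (D.A + D.B * D.gain P)) (hss : D.IsSteadyState (∫ w, w ∂ϱW) xs us) :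
    ∫ ω, X ω ∂μ = xs := by
  have hs := h.isSteadyState
  rw [integral_optFeedback (h.memLp_state.integrable one_le_two)] at hs
  refine sub_eq_zero.1 (hst.eq_zero_of_mulVec_eq ?_)
  have hdiff := hs.trans hss.symm
  simp only [optFeedback, add_mulVec, mulVec_add, mulVec_sub, sub_mulVec, one_mulVec,
    ← mulVec_mulVec] at hdiff ⊢
  rw [← sub_eq_zero] at hdiff ⊢
  rw [← neg_eq_zero, ← hdiff]
  abel

theorem IsWitness.stageCost_optFeedback [IsProbabilityMeasure μ]
    (h : D.IsWitness μ ϱW ϱ (D.optFeedback P xs us) X V) (hP : D.IsRiccatiSolution P)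
    (hst : SchurStable (D.A + D.B * D.gain P)) (hss : D.IsSteadyState (∫ w, w ∂ϱW) xs us) :
    D.stageCost μ X (D.optFeedback P xs us ∘ X) = D.detCost xs us + D.noiseCost ϱW P := by
  rw [h.stageCost_eq hP, gainPenalty_optFeedback,
    integral_optFeedback (h.memLp_state.integrable one_le_two),
    h.integral_state_of_optFeedback hst hss, optFeedback, sub_self, mulVec_zero, zero_add, add_zero]

theorem IsWitness.map_conv_eq [IsProbabilityMeasure μ]
    (h : D.IsWitness μ ϱW ϱ (D.optFeedback P xs us) X V) :
    ϱ.map (D.closedLoopMap P) ∗ ϱW.map (D.closedLoopNoise P xs us) = ϱ := by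
  have hX := h.memLp_state.aemeasurable
  have hV := h.memLp_noise.aemeasurable
  have hT := (D.closedLoopMap P).measurable
  have hg : Measurable (D.closedLoopNoise P xs us) := measurable_closedLoopNoise
  have hlaw_map : ϱ.map (D.closedLoopMap P) = μ.map (D.closedLoopMap P ∘ X) := by
    rw [← h.law_state, AEMeasurable.map_map_of_aemeasurable hT.aemeasurable hX]
  have hlaw_noise : ϱW.map (D.closedLoopNoise P xs us) = μ.map (D.closedLoopNoise P xs us ∘ V) := by
    rw [← h.law_noise, AEMeasurable.map_map_of_aemeasurable hg.aemeasurable hV]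
  have hlaw_next := h.law_next
  simp only [f_optFeedback (X _)] at hlaw_next
  rw [hlaw_map, hlaw_noise, ← (h.indep.comp hT hg).map_add_eq_map_conv_map₀
    (hT.comp_aemeasurable hX) (hg.comp_aemeasurable hV)]
  exact hlaw_next

theorem IsFeasible.eq_of_optFeedback [IsProbabilityMeasure μ]
    (h : D.IsFeasible μ ϱW ϱ (D.optFeedback P xs us))
    (h' : D.IsFeasible μ ϱW ϱ' (D.optFeedback P xs us))
    (hst : SchurStable (D.A + D.B * D.gain P)) : ϱ = ϱ' := by
  have hϱ := h.memP2.1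
  have hϱ' := h'.memP2.1
  obtain ⟨X, V, h⟩ := h
  obtain ⟨X', V', h'⟩ := h'
  have hϱW : IsProbabilityMeasure ϱW :=
    h.law_noise ▸ Measure.isProbabilityMeasure_map h.memLp_noise.aemeasurable
  have hν : IsProbabilityMeasure (ϱW.map (D.closedLoopNoise P xs us)) :=
    Measure.isProbabilityMeasure_map measurable_closedLoopNoise.aemeasurable
  have hnorm := (summable_norm_closedLoopMap_pow hst).tendsto_atTop_zero
  have hT (x : Fin n → ℝ) : Tendsto (fun k => (D.closedLoopMap P ^ k) x) atTop (𝓝 0) :=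
    squeeze_zero_norm (fun k => ContinuousLinearMap.le_opNorm _ x)
      (by simpa only [zero_mul] using hnorm.mul_const ‖x‖)
  exact eq_of_map_conv_eq hT h.map_conv_eq h'.map_conv_eq

theorem exists_isFeasible_optFeedback [IsProbabilityMeasure μ] {W : ℕ → Ω → Fin m → ℝ}
    (hst : SchurStable (D.A + D.B * D.gain P)) (xs : Fin n → ℝ) (us : Fin l → ℝ)
    (hW_memLp : ∀ k, MemLp (W k) 2 μ) (hW_law : ∀ k, μ.map (W k) = ϱW)
    (hW_indep : iIndepFun W μ) : ∃ ϱ, D.IsFeasible μ ϱW ϱ (D.optFeedback P xs us) := by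
  have hT := summable_norm_closedLoopMap_pow hst
  have hg : Measurable (D.closedLoopNoise P xs us) := measurable_closedLoopNoise
  have hident (k : ℕ) : IdentDistrib (fun ω => D.closedLoopNoise P xs us (W k ω))
      (fun ω => D.closedLoopNoise P xs us (W 0 ω)) μ μ :=
    IdentDistrib.comp ⟨(hW_memLp k).aemeasurable, (hW_memLp 0).aemeasurable,
      (hW_law k).trans (hW_law 0).symm⟩ hg
  have hgW (k : ℕ) : MemLp (fun ω => D.closedLoopNoise P xs us (W k ω)) 2 μ :=
    memLp_closedLoopNoise (hW_memLp k)
  have hseries : Measurable fun w : ℕ → Fin m → ℝ =>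
      noiseSeries (D.closedLoopMap P) fun k => D.closedLoopNoise P xs us (w k) :=
    (measurable_noiseSeries _).comp (by fun_prop)
  have hpast : IndepFun (fun ω k => W (k + 1) ω) (W 0) μ :=
    indepFun_process_of_notMem_range hW_indep (fun k => (hW_memLp k).aemeasurable)
      (g := Nat.succ) (by simp)
  have hnext := identDistrib_apply_noiseSeries_add hT (hW_indep.comp _ fun _ => hg) hident (hgW 0)
  refine ⟨_, fun ω => noiseSeries (D.closedLoopMap P) fun k =>
    D.closedLoopNoise P xs us (W (k + 1) ω), W 0, {
      feedback := isFeedback_optFeedback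
      memLp_state := memLp_noiseSeries hT (fun k => hgW (k + 1)) (hgW 0).2.ne
        fun k => ((hident (k + 1)).eLpNorm_eq 2).le
      memLp_noise := hW_memLp 0
      law_state := rfl
      law_noise := hW_law 0
      indep := hpast.comp hseries measurable_id
      law_next := ?_ }⟩
  simp only [f_optFeedback (noiseSeries _ _)]
  exact hnext.map_eq

end OptFeedback

end Data

end StochLQ

theorem mainTheorem6 {n l m : ℕ} (D : StochLQ.Data n l m)
    {Ω : Type*} [MeasurableSpace Ω] (μ : Measure Ω) [IsProbabilityMeasure μ]
    (ϱW : Measure (Fin m → ℝ)) (W : ℕ → Ω → Fin m → ℝ)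
    (hW_memLp : ∀ k, MemLp (W k) 2 μ)
    (hW_law : ∀ k, μ.map (W k) = ϱW)
    (hW_indep : iIndepFun W μ)
    (hsteady : ∃ xs us, D.IsSteadyState (∫ w, w ∂ϱW) xs us)
    (hdetect : StochLQ.Detectable D.A (CFC.sqrt D.Q₁)) :
    (∃! P, D.IsRiccatiSolution P) ∧
    (∃! p : (Fin n → ℝ) × (Fin l → ℝ), D.IsOptimalSteadyState (∫ w, w ∂ϱW) p.1 p.2) ∧
    ∀ P, D.IsRiccatiSolution P →
    ∀ xs us, D.IsOptimalSteadyState (∫ w, w ∂ϱW) xs us →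
      ∃ ϱs : Measure (Fin n → ℝ), StochLQ.MemP2 ϱs ∧
        (∀ ϱ, D.IsFeasible μ ϱW ϱ (D.optFeedback P xs us) ↔ ϱ = ϱs) ∧
        D.IsSolution μ ϱW ϱs (D.optFeedback P xs us) ∧
        ∀ ϱ' π', D.IsSolution μ ϱW ϱ' π' → ϱ' = ϱs := by
  have huniq := D.existsUnique_isOptimalSteadyState hdetect hsteady
  refine ⟨StochLQ.Data.existsUnique_isRiccatiSolution hdetect, huniq, fun P hP xs us hopt => ?_⟩
  have hst := hP.schurStable hdetect
  obtain ⟨ϱs, hfeas⟩ :=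
    StochLQ.Data.exists_isFeasible_optFeedback hst xs us hW_memLp hW_law hW_indep
  refine ⟨ϱs, hfeas.memP2, fun ϱ => ⟨fun h => h.eq_of_optFeedback hfeas hst, fun h => h ▸ hfeas⟩,
    ⟨hfeas, fun X V h ϱ' π' X' V' h' => ?_⟩, fun ϱ' π' ⟨⟨X', V', h'⟩, hmin⟩ => ?_⟩
  · rw [h.stageCost_optFeedback hP hst hopt.1]
    exact h'.detCost_add_noiseCost_le_stageCost hP hopt
  · obtain ⟨X, V, h⟩ := id hfeas
    have hle := hmin X' V' h' ϱs _ X V h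
    rw [h.stageCost_optFeedback hP hst hopt.1] at hle
    have hfeas' : D.IsFeasible μ ϱW ϱ' (D.optFeedback P xs us) :=
      ⟨X', V', h'.optFeedback_of_stageCost_le hP huniq hopt hle⟩
    exact hfeas'.eq_of_optFeedback hfeas hst
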